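/- Let $k \ge 1$ be an integer, $x \in \{3,4,5\}$, $m = 4k+x$ and $\theta = 2\pi/m$. Around each point $u$ of the plane consider $m$ cones of aperture $\theta$ with apex $u$, bounded by consecutive rays from $u$; they are oriented so that the bisector of the cone $C_0^u$ points vertically upward, and are numbered $C_0^u, C_1^u, \dots, C_{m-1}^u$ in clockwise order. Let $P$ be a finite set of points in the plane in general position: no two points lie on a line parallel to one of the rays that bound the cones, no two points lie on a line perpendicular to the bisector of a cone, and no three points are collinear. Let $S$ be a set of line segments between distinct points of $P$ (constraints), no two of which intersect properly. Two distinct points $u, v \in P$ can see each other if $uv$ is a constraint or does not properly intersect any constraint. For $u \in P$, the constraints with one endpoint $u$ and the other endpoint in $C_i^u$ split $C_i^u$ into closed subcones (a cone that is not split is a single subcone; the other endpoint of a splitting constraint lies in both adjacent subcones). The constrained $\theta_m$-graph has vertex set $P$ and is obtained by adding, for every $u \in P$ and every subcone of every cone $C_i^u$, an edge from $u$ to the point of $P$ in that subcone that can see $u$ and whose orthogonal projection on the bisector of $C_i^u$ is closest to $u$. For $w \in C_i^u$, the canonical triangle of $u$ and $w$ is the triangle bounded by the two border rays of $C_i^u$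 and the line through $w$ perpendicular to the bisector of $C_i^u$. Theorem. Put \[ c = \frac{1}{\cos(\theta/2) - \sin(\theta/2)} \text{ if } x = 4, \qquad c = \frac{\cos(\theta/4)}{\cos(\theta/2) - \sin(3\theta/4)} \text{ if } x \in \{3, 5\}. \] Then $c \ge 1$, and the following holds for all $P$ and $S$ as above. Let $u, w \in P$ be distinct points that can see each other, let $m_{uw}$ be the midpoint of the side opposite $u$ of the canonical triangle of $u$ and $w$, and let $\alpha$ be the unsigned angle between $uw$ and $u m_{uw}$. Then there is a path between $u$ and $w$ in the constrained $\theta_m$-graph whose Euclidean length is at most \[ \left( \frac{\cos\alpha}{\cos(\theta/2)} + \left( \cos\alpha \cdot \tan(\theta/2) + \sin\alpha \right) \cdot c \right) \cdot |uw|. \] -/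

import Mathlib

namespace ConstrainedTheta

noncomputable section

/-- The Euclidean plane; coordinate `0` is horizontal, coordinate `1` is vertical. -/
abbrev Plane := EuclideanSpace ℝ (Fin 2)

/-- The unit vector at clockwise angle `φ` from the upward vertical direction. -/
def direction (φ : ℝ) : Plane := !₂[Real.sin φ, Real.cos φ]

/-- The aperture `θ = 2π / m` of each of the `m` cones around a point. -/
def aperture (m : ℕ) : ℝ := 2 * Real.pi / m

/-- Direction of the bisector of the `i`-th cone. The cones are numbered clockwise and the bisector
of cone `0` points vertically upward; indices are read modulo `m`. -/
def bisector (m : ℕ) (i : ℤ) : Plane := direction (i * aperture m)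

/-- Direction of the counterclockwise (left) boundary ray of the `i`-th cone. -/
def leftRay (m : ℕ) (i : ℤ) : Plane := direction ((i - 1 / 2) * aperture m)

/-- Direction of the clockwise (right) boundary ray of the `i`-th cone. -/
def rightRay (m : ℕ) (i : ℤ) : Plane := direction ((i + 1 / 2) * aperture m)

/-- The closed region between the rays from `u` in directions `d₁` and `d₂` (for directions that
make an angle less than `π`). -/
def sector (u d₁ d₂ : Plane) : Set Plane :=
  {p | ∃ s t : ℝ, 0 ≤ s ∧ 0 ≤ t ∧ p = u + s • d₁ + t • d₂}

/-- The cone `C_i^u`. -/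
def cone (m : ℕ) (u : Plane) (i : ℤ) : Set Plane := sector u (leftRay m i) (rightRay m i)

/-- The orthogonal projection of `v` on the line through `u` along the bisector of `C_i^u`. -/
def bisectorProj (m : ℕ) (u : Plane) (i : ℤ) (v : Plane) : Plane :=
  u + inner ℝ (v - u) (bisector m i) • bisector m i

/-- For `w` in `C_i^u`, the left corner opposite `u` of the canonical triangle of `u` and `w`: the
point of the left border of `C_i^u` on the line through `w` perpendicular to the bisector. -/
def leftCorner (m : ℕ) (u : Plane) (i : ℤ) (w : Plane) : Plane :=
  u + (inner ℝ (w - u) (bisector m i) / Real.cos (aperture m / 2)) • leftRay m i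

/-- The right corner opposite `u` of the canonical triangle of `u` and `w`. -/
def rightCorner (m : ℕ) (u : Plane) (i : ℤ) (w : Plane) : Plane :=
  u + (inner ℝ (w - u) (bisector m i) / Real.cos (aperture m / 2)) • rightRay m i

/-- The midpoint of the side opposite `u` of the canonical triangle of `u` and `w`. -/
def canonicalMidpoint (m : ℕ) (u : Plane) (i : ℤ) (w : Plane) : Plane :=
  midpoint ℝ (leftCorner m u i w) (rightCorner m u i w)

/-- General position with respect to the `m` cone directions. -/
structure GeneralPosition (m : ℕ) (P : Finset Plane) : Prop where
  /-- no two points on a line parallel to one of the boundary rays of the cones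
  (every boundary ray is the right boundary ray of some cone) -/
  not_parallel : ∀ u ∈ P, ∀ v ∈ P, u ≠ v → ∀ (i : ℤ) (t : ℝ), v - u ≠ t • rightRay m i
  /-- no two points on a line perpendicular to the bisector of a cone -/
  not_perpendicular : ∀ u ∈ P, ∀ v ∈ P, u ≠ v → ∀ i : ℤ, inner ℝ (v - u) (bisector m i) ≠ 0
  /-- no three points collinear -/
  not_collinear : ∀ u ∈ P, ∀ v ∈ P, ∀ w ∈ P, u ≠ v → v ≠ w → u ≠ w → ¬ Collinear ℝ {u, v, w}

/-- The segments `ab` and `cd` intersect properly: their relative interiors meet in exactly one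
point. -/
def ProperlyIntersect (a b c d : Plane) : Prop :=
  ∃ x, openSegment ℝ a b ∩ openSegment ℝ c d = {x}

variable {P : Finset Plane}

/-- A set of constraints on `P`, given by its adjacency relation `S.Adj a b` ("the segment `ab` is a
constraint"), is planar: no two constraints intersect properly. -/
def PlanarConstraints (S : SimpleGraph P) : Prop :=
  ∀ a b c d : P, S.Adj a b → S.Adj c d → ¬ ProperlyIntersect (a : Plane) b c d

/-- The visibility graph `Vis(P, S)`: distinct vertices `u`, `v` can see each other when `uv` is a
constraint or does not properly intersect any constraint. -/
def visibilityGraph (S : SimpleGraph P) : SimpleGraph P where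
  Adj u v := u ≠ v ∧
    ((∀ a b : P, S.Adj a b → ¬ ProperlyIntersect (u : Plane) v a b) ∨ S.Adj u v)
  symm := ⟨by
    rintro u v ⟨hne, h⟩
    refine ⟨hne.symm, h.imp (fun h a b hab => ?_) (fun h => h.symm)⟩
    have := h a b hab
    unfold ProperlyIntersect at this ⊢
    rwa [openSegment_symm]⟩
  loopless := ⟨fun _ h => h.1 rfl⟩

/-- `d₂` is obtained from `d₁` by a clockwise rotation by an angle strictly between `0` and `π`,
up to positive scaling. -/
def Clockwise (d₁ d₂ : Plane) : Prop := 0 < d₁ 1 * d₂ 0 - d₁ 0 * d₂ 1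

/-- The directions of the rays that bound the subcones of `C_i^u`: the two borders of the cone, and
the constraints with endpoint `u` whose other endpoint lies in `C_i^u`. -/
def IsDivider (m : ℕ) (S : SimpleGraph P) (u : P) (i : ℤ) (d : Plane) : Prop :=
  d = leftRay m i ∨ d = rightRay m i ∨
    ∃ q : P, S.Adj u q ∧ (q : Plane) ∈ cone m u i ∧ d = (q : Plane) - u

/-- `K` is one of the (closed) subcones into which `C_i^u` is split by the constraints with endpoint
`u` and other endpoint in `C_i^u`: the region between two consecutive dividing rays. -/
def IsSubcone (m : ℕ) (S : SimpleGraph P) (u : P) (i : ℤ) (K : Set Plane) : Prop :=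
  ∃ d₁ d₂ : Plane, IsDivider m S u i d₁ ∧ IsDivider m S u i d₂ ∧ Clockwise d₁ d₂ ∧
    (∀ d, IsDivider m S u i d → ¬ (Clockwise d₁ d ∧ Clockwise d d₂)) ∧ K = sector u d₁ d₂

/-- In some subcone of `u`, the vertex `v` is closest to `u` among the vertices that can see `u`,
distance being measured along the bisector of the original cone. -/
def Selects (m : ℕ) (S : SimpleGraph P) (u v : P) : Prop :=
  (visibilityGraph S).Adj u v ∧ ∃ (i : ℤ) (K : Set Plane), IsSubcone m S u i K ∧ (v : Plane) ∈ K ∧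
    ∀ w : P, (visibilityGraph S).Adj u w → (w : Plane) ∈ K →
      dist (u : Plane) (bisectorProj m u i v) ≤ dist (u : Plane) (bisectorProj m u i w)

/-- The constrained `θ_m`-graph on the vertex set `P` with constraints `S`. -/
def constrainedThetaGraph (m : ℕ) (S : SimpleGraph P) : SimpleGraph P where
  Adj u v := Selects m S u v ∨ Selects m S v u
  symm := ⟨fun _ _ h => h.symm⟩
  loopless := ⟨fun _ h => h.elim (fun h => h.1.1 rfl) (fun h => h.1.1 rfl)⟩

/-- The total Euclidean length of the edges of a walk. -/
def walkLength {G : SimpleGraph P} {u v : P} (p : G.Walk u v) : ℝ :=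
  (p.darts.map fun e => dist (e.fst : Plane) (e.snd : Plane)).sum

end

end ConstrainedTheta

open ConstrainedTheta

/-! Write h and l for the coordinates of w - u along and across the bisector of a cone. The claimed
bound is h / cos(θ/2) + c (h tan(θ/2) + |l|) (`pathBound`, `pathBound_eq_angle`). It is proved by
induction on |uw|, for all visible pairs and all cones at once (`reach_of_visible`).

In the subcone of u that contains w, let v be the visible vertex with the lowest projection, so that
uv is an edge of the graph. If v ≠ w, no constraint at u runs strictly between uv and uw. Gift
wrapping in the triangle uvw therefore yields a convex chain from v to w whose consecutive vertices
see each other (`exists_next`). Because m ≥ 7, every chain edge is shorter than uw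
(`chain_edge_sq_lt`), so the induction hypothesis applies to it.

A chain edge may lie in a cone with another bisector. The constant c is chosen so that, for every
displacement rising along the original bisector, some cone at one of its two endpoints gives a bound
no larger than the one measured with the original bisector (`exists_cheaper_cone`). This rests on
the concavity of cos φ + c sin(θ/2 + φ).

All bounds now refer to one bisector and can be added along the chain (`reach_of_chain`). With |l|
replaced by l or -l the bound is additive. By convexity the lateral direction of the chain reverses
at most once, and when it does, uv and uw lie on the side of the bisector where exchanging the sign
can only increase the bound. -/

namespace ConstrainedTheta

/-! ### Signed areas and affine frames. -/

/-- Twice the signed area spanned by `d` and `d'`, positive when `d'` is clockwise of `d`. -/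
def cr (d d' : Plane) : ℝ := d 1 * d' 0 - d 0 * d' 1

lemma plane_ext {z z' : Plane} (h0 : z 0 = z' 0) (h1 : z 1 = z' 1) : z = z' := by
  ext i
  fin_cases i
  exacts [h0, h1]

lemma exists_smul_of_cr_eq_zero {d d' : Plane} (hd : d ≠ 0) (h : cr d d' = 0) :
    ∃ r : ℝ, d' = r • d := by
  unfold cr at h
  have hpos : d 0 * d 0 + d 1 * d 1 ≠ 0 := fun h0 => hd <| plane_ext
    (by simp; nlinarith [mul_self_nonneg (d 0), mul_self_nonneg (d 1)])
    (by simp; nlinarith [mul_self_nonneg (d 0), mul_self_nonneg (d 1)])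
  refine ⟨(d 0 * d' 0 + d 1 * d' 1) / (d 0 * d 0 + d 1 * d 1), plane_ext ?_ ?_⟩
  · simp only [PiLp.smul_apply, smul_eq_mul]
    rw [div_mul_eq_mul_div, eq_div_iff hpos]
    linear_combination d 1 * h
  · simp only [PiLp.smul_apply, smul_eq_mul]
    rw [div_mul_eq_mul_div, eq_div_iff hpos]
    linear_combination -d 0 * h

lemma cr_ne_zero_of_not_collinear {u v w : Plane} (h : ¬ Collinear ℝ {u, v, w}) :
    cr (v - u) (w - u) ≠ 0 := by
  intro h0
  apply h
  by_cases hvu : v - u = 0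
  · rw [sub_eq_zero.1 hvu]
    simpa using collinear_pair ℝ u w
  · obtain ⟨r, hr⟩ := exists_smul_of_cr_eq_zero hvu h0
    rw [collinear_iff_of_mem (p₀ := u) (by simp)]
    refine ⟨v - u, ?_⟩
    simp only [Set.mem_insert_iff, Set.mem_singleton_iff, forall_eq_or_imp, forall_eq]
    refine ⟨⟨0, by simp⟩, ⟨1, by simp⟩, ⟨r, by simp [← hr]⟩⟩

/-- First coordinate of `z` in the affine frame with origin `u` and basis `v - u`, `w - u`. -/
noncomputable def bcl (u v w z : Plane) : ℝ := cr (z - u) (w - u) / cr (v - u) (w - u)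

/-- Second coordinate of `z` in the affine frame with origin `u` and basis `v - u`, `w - u`. -/
noncomputable def bcr (u v w z : Plane) : ℝ := cr (v - u) (z - u) / cr (v - u) (w - u)

lemma eq_frame {u v w : Plane} (hD : cr (v - u) (w - u) ≠ 0) (z : Plane) : z = u + (bcl u v w z • (v - u) + bcr u v w z • (w - u)) := by
  unfold bcl bcr
  apply plane_ext <;> simp only [PiLp.add_apply, PiLp.smul_apply, smul_eq_mul, PiLp.sub_apply] <;>
    field_simp <;> simp only [cr, PiLp.sub_apply] <;> ring

lemma bcl_frame {u v w : Plane} (hD : cr (v - u) (w - u) ≠ 0) (s t : ℝ) : bcl u v w (u + (s • (v - u) + t • (w - u))) = s := by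
  unfold bcl
  rw [div_eq_iff hD]
  simp [cr]
  ring

lemma bcr_frame {u v w : Plane} (hD : cr (v - u) (w - u) ≠ 0) (s t : ℝ) : bcr u v w (u + (s • (v - u) + t • (w - u))) = t := by
  unfold bcr
  rw [div_eq_iff hD]
  simp [cr]
  ring

lemma bcl_lineMap (u v w a b : Plane) (r : ℝ) :
    bcl u v w (a + r • (b - a)) = bcl u v w a + r * (bcl u v w b - bcl u v w a) := by
  unfold bcl
  rw [← sub_div, mul_div_assoc', ← add_div]
  congr 1
  simp [cr]
  ring

lemma bcr_lineMap (u v w a b : Plane) (r : ℝ) :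
    bcr u v w (a + r • (b - a)) = bcr u v w a + r * (bcr u v w b - bcr u v w a) := by
  unfold bcr
  rw [← sub_div, mul_div_assoc', ← add_div]
  congr 1
  simp [cr]
  ring

/-! ### Visibility inside a triangle. -/

/-- A segment that starts inside a triangle with a corner at the origin, ends on the same side of
the opposite side, and avoids the two sides on the axes, ends in the first quadrant. -/
lemma nonneg_of_avoids_left {k x1 x2 e1 e2 : ℝ} (hk : 1 ≤ k) (hx1 : 0 < x1) (hx2 : 0 < x2)
    (hx : x1 + k * x2 ≤ 1) (he : e1 + k * e2 < 1)
    (h1 : ∀ r, 0 < r → r < 1 → x2 + r * (e2 - x2) = 0 → 0 < x1 + r * (e1 - x1) →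
      1 ≤ x1 + r * (e1 - x1))
    (h2 : ∀ r, 0 < r → r < 1 → x1 + r * (e1 - x1) = 0 → 0 < x2 + r * (e2 - x2) →
      1 ≤ x2 + r * (e2 - x2))
    (h0 : ∀ r, 0 < r → r ≤ 1 → x1 + r * (e1 - x1) = 0 → x2 + r * (e2 - x2) ≠ 0) :
    0 ≤ e1 ∧ 0 ≤ e2 := by
  have key2 : e2 < 0 → ∃ r, 0 < r ∧ r < 1 ∧ x2 + r * (e2 - x2) = 0 ∧ x1 + r * (e1 - x1) < 0 := by
    intro h
    have hp : 0 < x2 - e2 := by linarith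
    have hr0 : 0 < x2 / (x2 - e2) := div_pos hx2 hp
    have hr1 : x2 / (x2 - e2) < 1 := (div_lt_one hp).2 (by linarith)
    have hz : x2 + x2 / (x2 - e2) * (e2 - x2) = 0 := by field_simp; ring
    refine ⟨x2 / (x2 - e2), hr0, hr1, hz, ?_⟩
    set r := x2 / (x2 - e2)
    -- At the crossing `x1 + k * x2 < 1` still holds, being a strict bound at the end `e`; so a
    -- positive first coordinate would be below 1, against `h1`.
    by_contra! hc
    rcases hc.eq_or_lt with hc | hc
    · exact h0 r hr0 hr1.le hc.symm hz
    · have := h1 r hr0 hr1 hz hc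
      nlinarith
  have key1 : e1 < 0 → ∃ r, 0 < r ∧ r < 1 ∧ x1 + r * (e1 - x1) = 0 ∧ x2 + r * (e2 - x2) < 0 := by
    intro h
    have hp : 0 < x1 - e1 := by linarith
    have hr0 : 0 < x1 / (x1 - e1) := div_pos hx1 hp
    have hr1 : x1 / (x1 - e1) < 1 := (div_lt_one hp).2 (by linarith)
    have hz : x1 + x1 / (x1 - e1) * (e1 - x1) = 0 := by field_simp; ring
    refine ⟨x1 / (x1 - e1), hr0, hr1, hz, ?_⟩
    set r := x1 / (x1 - e1)
    by_contra! hc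
    rcases hc.eq_or_lt with hc | hc
    · exact h0 r hr0 hr1.le hz hc.symm
    · have := h2 r hr0 hr1 hz hc
      nlinarith
  -- If both coordinates became negative, each axis would have to be crossed strictly before the
  -- other.
  have both : e1 < 0 → e2 < 0 → False := by
    intro a b
    obtain ⟨r, r0, r1, ra, rb⟩ := key1 a
    obtain ⟨r', r0', r1', ra', rb'⟩ := key2 b
    have h : (r' - r) * (x1 - e1) > 0 := by linarith
    have h' : (r - r') * (x2 - e2) > 0 := by linarith
    have hlt : 0 < r' - r := pos_of_mul_pos_left h (by linarith)
    have hlt' : 0 < r - r' := pos_of_mul_pos_left h' (by linarith)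
    linarith
  constructor
  · by_contra! h
    obtain ⟨r, r0, r1, ra, rb⟩ := key1 h
    refine both h ?_
    nlinarith
  · by_contra! h
    obtain ⟨r, r0, r1, ra, rb⟩ := key2 h
    refine both ?_ h
    nlinarith

lemma mem_openSegment_iff {a b x : Plane} :
    x ∈ openSegment ℝ a b ↔ ∃ r : ℝ, 0 < r ∧ r < 1 ∧ x = a + r • (b - a) := by
  rw [openSegment_eq_image']
  constructor
  · rintro ⟨r, ⟨h0, h1⟩, rfl⟩
    exact ⟨r, h0, h1, rfl⟩
  · rintro ⟨r, h0, h1, rfl⟩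
    exact ⟨r, ⟨h0, h1⟩, rfl⟩

/-- If the segment `ab` meets the triangle `u`, `v`, `u + k⁻¹ (w - u)`, but not the open segments
`uv` and `uw`, and `b` is on the same side of the side opposite `u` as `u`, then `b` lies in the
wedge between `uv` and `uw`. -/
lemma endpoint_mem_wedge {u v w a b x : Plane} {k : ℝ} (hD : cr (v - u) (w - u) ≠ 0) (hk : 1 ≤ k)
    (hx : x ∈ openSegment ℝ a b) (hx1 : 0 < bcl u v w x) (hx2 : 0 < bcr u v w x)
    (hxk : bcl u v w x + k * bcr u v w x ≤ 1) (hbk : bcl u v w b + k * bcr u v w b < 1)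
    (hv : ∀ q ∈ openSegment ℝ a b, q ∉ openSegment ℝ u v)
    (hw : ∀ q ∈ openSegment ℝ a b, q ∉ openSegment ℝ u w)
    (hu : u ∉ openSegment ℝ a b) (hub : u ≠ b) :
    0 ≤ bcl u v w b ∧ 0 ≤ bcr u v w b := by
  obtain ⟨μ, hμ0, hμ1, rfl⟩ := mem_openSegment_iff.1 hx
  set x := a + μ • (b - a) with hxdef
  have hq : ∀ r : ℝ, 0 < r → r < 1 → x + r • (b - x) ∈ openSegment ℝ a b := by
    intro r h0 h1
    refine mem_openSegment_iff.2 ⟨μ + r * (1 - μ), by nlinarith, by nlinarith, ?_⟩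
    rw [hxdef]
    module
  refine nonneg_of_avoids_left hk hx1 hx2 hxk hbk ?_ ?_ ?_
  · intro r h0 h1 hz hp
    by_contra! hlt
    apply hv _ (hq r h0 h1)
    rw [mem_openSegment_iff]
    refine ⟨_, hp, hlt, ?_⟩
    conv_lhs => rw [eq_frame hD (x + r • (b - x)), bcr_lineMap, hz, bcl_lineMap]
    module
  · intro r h0 h1 hz hp
    by_contra! hlt
    apply hw _ (hq r h0 h1)
    rw [mem_openSegment_iff]
    refine ⟨_, hp, hlt, ?_⟩
    conv_lhs => rw [eq_frame hD (x + r • (b - x)), bcl_lineMap, hz, bcr_lineMap]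
    module
  · intro r h0 h1 hz hz'
    have hqu : x + r • (b - x) = u := by
      rw [eq_frame hD (x + r • (b - x)), bcl_lineMap, hz, bcr_lineMap, hz']
      module
    rcases h1.eq_or_lt with rfl | h1
    · apply hub
      rw [← hqu]
      module
    · exact hu (hqu ▸ hq r h0 h1)

/-- No three points of `P` are collinear, in terms of `cr`. -/
def NoThreeCollinear (P : Finset Plane) : Prop :=
  ∀ u v w : P, u ≠ v → v ≠ w → u ≠ w → cr ((v : Plane) - u) ((w : Plane) - u) ≠ 0

lemma GeneralPosition.noThreeCollinear {m : ℕ} {P : Finset Plane} (h : GeneralPosition m P) :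
    NoThreeCollinear P := fun u v w huv hvw huw =>
  cr_ne_zero_of_not_collinear (h.not_collinear u u.2 v v.2 w w.2
    (fun e => huv (Subtype.ext e)) (fun e => hvw (Subtype.ext e)) (fun e => huw (Subtype.ext e)))

lemma NoThreeCollinear.notMem_openSegment {P : Finset Plane} (h : NoThreeCollinear P) {u a b : P}
    (hab : a ≠ b) (hau : a ≠ u) (hbu : b ≠ u) : (u : Plane) ∉ openSegment ℝ (a : Plane) b := by
  intro hu
  obtain ⟨r, -, -, hr⟩ := mem_openSegment_iff.1 hu
  apply h a b u hab hbu hau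
  rw [hr]
  simp [cr]
  ring

/-- The interior of a visibility edge `uv` does not meet the interior of a constraint that does not
have `u` as an endpoint. -/
lemma notMem_openSegment_of_visible {P : Finset Plane} {S : SimpleGraph P}
    (hP : NoThreeCollinear P) (hS : PlanarConstraints S) {u v a b : P}
    (huv : (visibilityGraph S).Adj u v) (hab : S.Adj a b) (hau : a ≠ u) (hbu : b ≠ u) :
    ∀ q ∈ openSegment ℝ (a : Plane) b, q ∉ openSegment ℝ (u : Plane) v := by
  intro q hq hq'
  have hprop : ProperlyIntersect (u : Plane) v a b := by
    refine ⟨q, Set.eq_singleton_iff_unique_mem.2 ⟨⟨hq', hq⟩, ?_⟩⟩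
    rintro p ⟨hp', hp⟩
    obtain ⟨r, hr0, -, hr⟩ := mem_openSegment_iff.1 hq'
    obtain ⟨s, -, -, hs⟩ := mem_openSegment_iff.1 hq
    obtain ⟨r', -, -, hr'⟩ := mem_openSegment_iff.1 hp'
    obtain ⟨s', -, -, hs'⟩ := mem_openSegment_iff.1 hp
    -- A second common point would make uv and ab parallel; sharing a point, they would lie on one
    -- line, and u, a, b would be collinear.
    have hne := hP u a b hau.symm hab.ne hbu.symm
    have e : ∀ i, (u : Plane) i + r * ((v : Plane) i - (u : Plane) i)
        = (a : Plane) i + s * ((b : Plane) i - (a : Plane) i) := fun i => by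
      have := congrArg (fun z : Plane => z i) (hr.symm.trans hs)
      simpa using this
    have e' : ∀ i, (u : Plane) i + r' * ((v : Plane) i - (u : Plane) i)
        = (a : Plane) i + s' * ((b : Plane) i - (a : Plane) i) := fun i => by
      have := congrArg (fun z : Plane => z i) (hr'.symm.trans hs')
      simpa using this
    have h1 : r * cr ((v : Plane) - u) ((b : Plane) - a)
        = cr ((a : Plane) - u) ((b : Plane) - u) := by
      simp only [cr, PiLp.sub_apply]
      linear_combination (((b : Plane) 0 - (a : Plane) 0)) * e 1
        - (((b : Plane) 1 - (a : Plane) 1)) * e 0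
    have h2 : (r' - r) * cr ((v : Plane) - u) ((b : Plane) - a) = 0 := by
      simp only [cr, PiLp.sub_apply]
      linear_combination (((b : Plane) 0 - (a : Plane) 0)) * (e' 1 - e 1)
        - (((b : Plane) 1 - (a : Plane) 1)) * (e' 0 - e 0)
    rcases mul_eq_zero.1 h2 with h3 | h3
    · rw [hr', hr, sub_eq_zero.1 h3]
    · rw [h3, mul_zero] at h1
      exact absurd h1.symm hne
  rcases huv.2 with h | h
  · exact h a b hab hprop
  · exact hS u v a b h hab hprop

/-- Gift wrapping: if `u` sees `v` and `w`, with no constraint at `u` between them, then the vertex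
`y` of the triangle `uvw` such that no vertex of the triangle is on the same side of `vy` as `u`
can be seen by both `u` and `v`. -/
lemma exists_next {P : Finset Plane} {S : SimpleGraph P}
    (hP : NoThreeCollinear P) (hS : PlanarConstraints S) {u v w : P}
    (huv : (visibilityGraph S).Adj u v) (huw : (visibilityGraph S).Adj u w) (hvw : v ≠ w)
    (hcon : ∀ q : P, S.Adj u q → ¬ (0 < bcl (u : Plane) v w q ∧ 0 < bcr (u : Plane) v w q)) :
    ∃ y : P, y ≠ u ∧ y ≠ v ∧ (visibilityGraph S).Adj u y ∧ (visibilityGraph S).Adj v y ∧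
      0 ≤ bcl (u : Plane) v w y ∧ 0 < bcr (u : Plane) v w y ∧
      bcl (u : Plane) v w y + bcr (u : Plane) v w y ≤ 1 ∧ (y = w ∨ 0 < bcl (u : Plane) v w y) ∧
      ∀ z : P, z ≠ u → 0 ≤ bcl (u : Plane) v w z → 0 ≤ bcr (u : Plane) v w z →
        bcl (u : Plane) v w z + bcr (u : Plane) v w z ≤ 1 →
        bcr (u : Plane) v w y
          ≤ bcl (u : Plane) v w z * bcr (u : Plane) v w y
            + bcr (u : Plane) v w z * (1 - bcl (u : Plane) v w y) := by
  have hD := hP u v w huv.1 hvw huw.1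
  set s : Plane → ℝ := bcl (u : Plane) v w with hs
  set t : Plane → ℝ := bcr (u : Plane) v w with ht
  have su : s u = 0 := by simp [hs, bcl, cr]
  have tu : t u = 0 := by simp [ht, bcr, cr]
  have sv : s v = 1 := by rw [hs, bcl]; exact div_self hD
  have tv : t v = 0 := by simp [ht, bcr, cr]; left; ring
  have sw : s w = 0 := by simp [hs, bcl, cr]; left; ring
  have tw : t w = 1 := by rw [ht, bcr]; exact div_self hD
  have tne : ∀ z : P, z ≠ u → z ≠ v → t z ≠ 0 := fun z h1 h2 =>
    div_ne_zero (hP u v z huv.1 h2.symm h1.symm) hD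
  have sne : ∀ z : P, z ≠ u → z ≠ w → s z ≠ 0 := fun z h1 h2 =>
    div_ne_zero (hP u z w h1.symm h2 huw.1) hD
  let Z : Set P := {z | z ≠ u ∧ z ≠ v ∧ 0 ≤ s z ∧ 0 ≤ t z ∧ s z + t z ≤ 1}
  have hwZ : w ∈ Z := ⟨huw.1.symm, hvw.symm, by rw [sw], by rw [tw]; norm_num,
    by rw [sw, tw]; norm_num⟩
  obtain ⟨y, ⟨hyu, hyv, hys, hyt, hyst⟩, hmin⟩ :=
    -- In the frame, v is (1, 0), so this quotient orders the vertices by their angle at v, measured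
    -- from vu.
    Set.exists_min_image Z (fun z => t z / (1 - s z)) (Set.toFinite Z) ⟨w, hwZ⟩
  have hyt' : 0 < t y := hyt.lt_of_ne (tne y hyu hyv).symm
  have hys1 : 0 < 1 - s y := by linarith
  have hall : ∀ z : P, z ≠ u → 0 ≤ s z → 0 ≤ t z → s z + t z ≤ 1 →
      t y ≤ s z * t y + t z * (1 - s y) := by
    intro z hzu h1 h2 h3
    by_cases hzv : z = v
    · rw [hzv, sv, tv]; linarith
    · have hzt : 0 < t z := h2.lt_of_ne (tne z hzu hzv).symm
      have := hmin z ⟨hzu, hzv, h1, h2, h3⟩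
      rw [div_le_div_iff₀ hys1 (by linarith)] at this
      linarith
  have hy' : y = w ∨ 0 < s y := by
    by_cases h : y = w
    · exact Or.inl h
    · exact Or.inr (hys.lt_of_ne (sne y hyu h).symm)
  -- The functional `s + k * t` vanishes at u and equals 1 exactly on the line vy.
  set k : ℝ := (1 - s y) / t y with hk
  have hk1 : 1 ≤ k := by rw [hk, one_le_div hyt']; linarith
  have hky : s y + k * t y = 1 := by rw [hk]; field_simp; ring
  have noend : ∀ z : P, z ≠ u → 0 ≤ s z → 0 ≤ t z → 1 ≤ s z + k * t z := by
    intro z hzu h1 h2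
    by_contra! hlt
    have := hall z hzu h1 h2 (by nlinarith)
    have h4 : k * t z * t y = t z * (1 - s y) := by rw [hk]; field_simp
    nlinarith
  -- An end on the near side of vy would be trapped in the wedge at u, where `noend` leaves no
  -- vertex. So a constraint meeting the triangle uvy has both ends on or beyond the line vy.
  have nocross : ∀ a b : P, S.Adj a b → a ≠ u → b ≠ u → ∀ x ∈ openSegment ℝ (a : Plane) b,
      0 < s x → 0 < t x → s x + k * t x ≤ 1 → 1 ≤ s b + k * t b := by
    intro a b hab hau hbu x hx h1 h2 h3
    by_contra! hlt
    have hmem := endpoint_mem_wedge hD hk1 hx h1 h2 h3 hlt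
      (notMem_openSegment_of_visible hP hS huv hab hau hbu)
      (notMem_openSegment_of_visible hP hS huw hab hau hbu)
      (hP.notMem_openSegment hab.ne hau hbu) (fun e => hbu (Subtype.ext e.symm))
    linarith [noend b hbu hmem.1 hmem.2]
  have nocross' : ∀ a b : P, S.Adj a b → a ≠ u → b ≠ u → ∀ x ∈ openSegment ℝ (a : Plane) b,
      0 < s x → 0 < t x → s x + k * t x ≤ 1 → 1 ≤ s a + k * t a ∧ 1 ≤ s b + k * t b := by
    intro a b hab hau hbu x hx h1 h2 h3
    exact ⟨nocross b a hab.symm hbu hau x (openSegment_symm ℝ (a : Plane) b ▸ hx) h1 h2 h3,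
      nocross a b hab hau hbu x hx h1 h2 h3⟩
  have slin : ∀ (a b : Plane) (r : ℝ), s (a + r • (b - a)) = s a + r * (s b - s a) :=
    fun a b r => bcl_lineMap _ _ _ a b r
  have tlin : ∀ (a b : Plane) (r : ℝ), t (a + r • (b - a)) = t a + r * (t b - t a) :=
    fun a b r => bcr_lineMap _ _ _ a b r
  refine ⟨y, hyu, hyv, ?_, ?_, hys, hyt', hyst, hy', hall⟩
  · rcases hy' with rfl | hys'
    · exact huw
    refine ⟨hyu.symm, ?_⟩
    by_cases hadj : S.Adj u y
    · exact Or.inr hadj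
    refine Or.inl fun a b hab hprop => ?_
    obtain ⟨x, hx⟩ := hprop
    obtain ⟨hx1, hx2⟩ : x ∈ openSegment ℝ (u : Plane) y ∩ openSegment ℝ (a : Plane) b := by
      rw [hx]; rfl
    have hend : ∀ b : P, S.Adj u b → x ∉ openSegment ℝ (u : Plane) b := by
      intro b hub hxb
      have hby : b ≠ y := fun e => hadj (e ▸ hub)
      obtain ⟨r, hr0, -, hr⟩ := mem_openSegment_iff.1 hx1
      obtain ⟨r', hr0', -, hr'⟩ := mem_openSegment_iff.1 hxb
      apply hP u b y hub.ne hby hyu.symm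
      have h1 : cr ((u : Plane) + r' • ((b : Plane) - u) - u) ((u : Plane) + r • ((y : Plane) - u) - u)
          = r' * r * cr ((b : Plane) - u) ((y : Plane) - u) := by
        simp [cr]
        ring
      have h2 : cr (x - u) (x - u) = 0 := by simp [cr]; ring
      rw [← hr', ← hr, h2] at h1
      have := mul_ne_zero hr0'.ne' hr0.ne'
      simpa [this] using h1.symm
    have hau : a ≠ u := by
      rintro rfl
      exact hend b hab hx2
    have hbu : b ≠ u := by
      rintro rfl
      exact hend a hab.symm (openSegment_symm ℝ (a : Plane) b ▸ hx2)
    obtain ⟨r, hr0, hr1, hr⟩ := mem_openSegment_iff.1 hx1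
    have hsx : s x = r * s y := by rw [hr, slin, su]; ring
    have htx : t x = r * t y := by rw [hr, tlin, tu]; ring
    have hfx : s x + k * t x < 1 := by rw [hsx, htx]; nlinarith
    have hends := nocross' a b hab hau hbu x hx2 (by rw [hsx]; positivity)
      (by rw [htx]; positivity) hfx.le
    obtain ⟨q, hq0, hq1, hq⟩ := mem_openSegment_iff.1 hx2
    rw [hq, slin, tlin] at hfx
    nlinarith
  · refine ⟨hyv.symm, ?_⟩
    by_cases hadj : S.Adj v y
    · exact Or.inr hadj
    refine Or.inl fun a b hab hprop => ?_
    obtain ⟨x, hx⟩ := hprop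
    obtain ⟨hx1, hx2⟩ : x ∈ openSegment ℝ (v : Plane) y ∩ openSegment ℝ (a : Plane) b := by
      rw [hx]; rfl
    obtain ⟨r, hr0, hr1, hr⟩ := mem_openSegment_iff.1 hx1
    have hsx : s x = 1 - r + r * s y := by rw [hr, slin, sv]; ring
    have htx : t x = r * t y := by rw [hr, tlin, tv]; ring
    have hsx0 : 0 < s x := by rw [hsx]; nlinarith
    have htx0 : 0 < t x := by rw [htx]; positivity
    have hfx : s x + k * t x = 1 := by rw [hsx, htx]; linear_combination r * hky
    have hend : ∀ b : P, S.Adj u b → x ∉ openSegment ℝ (u : Plane) b := by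
      intro b hub hxb
      obtain ⟨q, hq0, -, hq⟩ := mem_openSegment_iff.1 hxb
      apply hcon b hub
      have h1 : s x = q * s b := by rw [hq, slin, su]; ring
      have h2 : t x = q * t b := by rw [hq, tlin, tu]; ring
      rw [h1] at hsx0
      rw [h2] at htx0
      exact ⟨pos_of_mul_pos_right hsx0 hq0.le, pos_of_mul_pos_right htx0 hq0.le⟩
    have hau : a ≠ u := by
      rintro rfl
      exact hend b hab hx2
    have hbu : b ≠ u := by
      rintro rfl
      exact hend a hab.symm (openSegment_symm ℝ (a : Plane) b ▸ hx2)
    have hends := nocross' a b hab hau hbu x hx2 hsx0 htx0 hfx.le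
    obtain ⟨q, hq0, hq1, hq⟩ := mem_openSegment_iff.1 hx2
    have hfx' := hfx
    rw [hq, slin, tlin] at hfx'
    have ha1 : s a + k * t a = 1 := by nlinarith
    have hb1 : s b + k * t b = 1 := by nlinarith
    -- A constraint touching the interior of vy must have both ends on that line; without collinear
    -- triples it is vy itself.
    have onLine : ∀ z : P, s z + k * t z = 1 → z = v ∨ z = y := by
      intro z hz
      by_contra! hne
      apply hP v y z hyv.symm hne.2.symm hne.1.symm
      have e1 := eq_frame hD (y : Plane)
      have e2 := eq_frame hD (z : Plane)
      have hz' : s z = 1 - k * t z := by linarith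
      have hyy : s y = 1 - k * t y := by linarith
      rw [e1, e2]
      change cr (_ + (s y • _ + t y • _) - _) (_ + (s z • _ + t z • _) - _) = 0
      rw [hz', hyy]
      simp [cr]
      ring
    rcases onLine a ha1 with rfl | rfl <;> rcases onLine b hb1 with rfl | rfl
    · exact hab.ne rfl
    · exact hadj hab
    · exact hadj hab.symm
    · exact hab.ne rfl

/-! ### Coordinates along and across a bisector. -/

/-- Coordinate of `z` along `direction ψ`. -/
noncomputable def hgt (ψ : ℝ) (z : Plane) : ℝ := z 0 * Real.sin ψ + z 1 * Real.cos ψ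

/-- Coordinate of `z` perpendicular to `direction ψ`, positive on the clockwise side. -/
noncomputable def lat (ψ : ℝ) (z : Plane) : ℝ := z 0 * Real.cos ψ - z 1 * Real.sin ψ

/-- The bound on the length of a path that realizes the displacement `z` in a cone of aperture `θ`
with bisector `direction ψ`. -/
noncomputable def pathBound (θ c ψ : ℝ) (z : Plane) : ℝ :=
  hgt ψ z / Real.cos (θ / 2) + c * (hgt ψ z * Real.tan (θ / 2) + |lat ψ z|)

lemma inner_direction (z : Plane) (ψ : ℝ) : inner ℝ z (direction ψ) = hgt ψ z := by
  simp [direction, hgt, PiLp.inner_apply, Fin.sum_univ_two]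
  ring

lemma norm_sq_eq (ψ : ℝ) (z : Plane) : ‖z‖ ^ 2 = hgt ψ z ^ 2 + lat ψ z ^ 2 := by
  rw [EuclideanSpace.norm_sq_eq, Fin.sum_univ_two]
  simp only [Real.norm_eq_abs, sq_abs, hgt, lat]
  linear_combination -((z 0) ^ 2 + (z 1) ^ 2) * Real.sin_sq_add_cos_sq ψ

lemma cr_eq (ψ : ℝ) (d d' : Plane) : cr d d' = hgt ψ d * lat ψ d' - lat ψ d * hgt ψ d' := by
  simp only [cr, hgt, lat]
  linear_combination (d 0 * d' 1 - d 1 * d' 0) * Real.sin_sq_add_cos_sq ψ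

lemma eq_of_hgt_lat {ψ : ℝ} {z z' : Plane} (h : hgt ψ z = hgt ψ z') (l : lat ψ z = lat ψ z') :
    z = z' := by
  simp only [hgt, lat] at h l
  have := Real.sin_sq_add_cos_sq ψ
  apply plane_ext
  · linear_combination Real.sin ψ * h + Real.cos ψ * l + (z' 0 - z 0) * this
  · linear_combination Real.cos ψ * h - Real.sin ψ * l + (z' 1 - z 1) * this

lemma hgt_direction (ψ φ : ℝ) : hgt ψ (direction φ) = Real.cos (φ - ψ) := by
  simp [hgt, direction, Real.cos_sub]
  ring

lemma lat_direction (ψ φ : ℝ) : lat ψ (direction φ) = Real.sin (φ - ψ) := by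
  simp [lat, direction, Real.sin_sub]

lemma hgt_smul (ψ r : ℝ) (z : Plane) : hgt ψ (r • z) = r * hgt ψ z := by
  simp [hgt]; ring

lemma lat_smul (ψ r : ℝ) (z : Plane) : lat ψ (r • z) = r * lat ψ z := by
  simp [lat]; ring

lemma hgt_add (ψ : ℝ) (z z' : Plane) : hgt ψ (z + z') = hgt ψ z + hgt ψ z' := by
  simp [hgt]; ring

lemma lat_add (ψ : ℝ) (z z' : Plane) : lat ψ (z + z') = lat ψ z + lat ψ z' := by
  simp [lat]; ring

lemma hgt_sub (ψ : ℝ) (z z' : Plane) : hgt ψ (z - z') = hgt ψ z - hgt ψ z' := by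
  simp [hgt]; ring

lemma lat_sub (ψ : ℝ) (z z' : Plane) : lat ψ (z - z') = lat ψ z - lat ψ z' := by
  simp [lat]; ring

lemma mem_cone_iff {m : ℕ} (hs : 0 < Real.sin (aperture m / 2)) (hc : 0 < Real.cos (aperture m / 2))
    (u p : Plane) (i : ℤ) :
    p ∈ cone m u i ↔
      |lat (i * aperture m) (p - u)|
        ≤ Real.tan (aperture m / 2) * hgt (i * aperture m) (p - u) := by
  set θ := aperture m with hθ
  have hl : (((i : ℝ) - 1 / 2) * θ - i * θ) = -(θ / 2) := by ring
  have hr : (((i : ℝ) + 1 / 2) * θ - i * θ) = θ / 2 := by ring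
  have habs : ∀ l : ℝ, |l| * Real.cos (θ / 2) = |l * Real.cos (θ / 2)| := fun l => by
    rw [abs_mul, abs_of_pos hc]
  rw [Real.tan_eq_sin_div_cos, div_mul_eq_mul_div, le_div_iff₀ hc, habs, abs_le]
  constructor
  · rintro ⟨s, t, hs0, ht0, rfl⟩
    have e : u + s • leftRay m i + t • rightRay m i - u = s • leftRay m i + t • rightRay m i := by
      abel
    simp only [leftRay, rightRay, ← hθ] at e
    simp only [leftRay, rightRay, ← hθ, e, hgt_add, lat_add, hgt_smul, lat_smul, hgt_direction,
      lat_direction, hl, hr, Real.sin_neg, Real.cos_neg]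
    constructor <;> nlinarith [mul_nonneg hs0 (mul_nonneg hs.le hc.le),
      mul_nonneg ht0 (mul_nonneg hs.le hc.le)]
  · intro h
    set H := hgt (i * θ) (p - u) with hH
    set l := lat (i * θ) (p - u) with hl'
    refine ⟨(H / Real.cos (θ / 2) - l / Real.sin (θ / 2)) / 2,
      (H / Real.cos (θ / 2) + l / Real.sin (θ / 2)) / 2, ?_, ?_, ?_⟩
    · rw [div_sub_div _ _ hc.ne' hs.ne']
      have : 0 ≤ H * Real.sin (θ / 2) - Real.cos (θ / 2) * l := by linarith
      positivity
    · rw [div_add_div _ _ hc.ne' hs.ne']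
      have : 0 ≤ H * Real.sin (θ / 2) + Real.cos (θ / 2) * l := by linarith
      positivity
    · rw [add_assoc, ← sub_eq_iff_eq_add']
      refine eq_of_hgt_lat (ψ := i * θ) ?_ ?_
      · simp only [leftRay, rightRay, hgt_add, hgt_smul, hgt_direction, ← hθ, hl, hr, Real.cos_neg]
        rw [← hH]
        field_simp
        ring
      · simp only [leftRay, rightRay, lat_add, lat_smul, lat_direction, ← hθ, hl, hr, Real.sin_neg]
        rw [← hl']
        field_simp
        ring

/-! ### The bound as a concave function of the angle. -/

/-- `pathBound` in polar coordinates, up to the factor `cos (θ / 2)`. -/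
noncomputable def polarBound (θ c φ : ℝ) : ℝ := Real.cos φ + c * Real.sin (θ / 2 + φ)

lemma pathBound_smul_direction {θ c r ε : ℝ} (ψ : ℝ) (hc : 0 < Real.cos (θ / 2)) (hr : 0 ≤ r)
    (hε : |ε| ≤ Real.pi / 2) :
    pathBound θ c ψ (r • direction (ψ + ε)) = r * polarBound θ c |ε| / Real.cos (θ / 2) := by
  have hs : |Real.sin ε| = Real.sin |ε| := by
    rcases abs_cases ε with ⟨h, h0⟩ | ⟨h, h0⟩
    · rw [h] at hε ⊢
      exact abs_of_nonneg (Real.sin_nonneg_of_nonneg_of_le_pi h0 (by linarith [Real.pi_pos]))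
    · rw [h] at hε ⊢
      rw [← abs_neg, ← Real.sin_neg]
      exact abs_of_nonneg (Real.sin_nonneg_of_nonneg_of_le_pi (by linarith)
        (by linarith [Real.pi_pos]))
  rw [pathBound, hgt_smul, lat_smul, hgt_direction, lat_direction, add_sub_cancel_left, abs_mul,
    abs_of_nonneg hr, hs, polarBound, Real.sin_add, Real.cos_abs, Real.tan_eq_sin_div_cos]
  field_simp

lemma exists_polar (z : Plane) (ψ : ℝ) (h : 0 ≤ hgt ψ z) :
    ∃ r φ : ℝ, 0 ≤ r ∧ |φ| ≤ Real.pi / 2 ∧ z = r • direction (ψ + φ) := by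
  let y : ℂ := ⟨hgt ψ z, lat ψ z⟩
  refine ⟨‖y‖, y.arg, norm_nonneg _, Complex.abs_arg_le_pi_div_two_iff.2 h,
    eq_of_hgt_lat (ψ := ψ) ?_ ?_⟩
  · rw [hgt_smul, hgt_direction, add_sub_cancel_left, Complex.norm_mul_cos_arg]
  · rw [lat_smul, lat_direction, add_sub_cancel_left, Complex.norm_mul_sin_arg]

/-- On this range both angles stay in intervals where cosine and sine are concave. The weight of `a`
is strictly positive because φ < b, which lets `polarBound_le_of_le` divide by it. -/
lemma polarBound_concave {θ c a b φ : ℝ} (hθ0 : 0 ≤ θ) (hθ : θ ≤ Real.pi) (hc : 0 ≤ c) (ha : 0 ≤ a)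
    (hb : b ≤ Real.pi / 2) (haφ : a ≤ φ) (hφb : φ < b) :
    ∃ x y : ℝ, 0 < x ∧ 0 ≤ y ∧ x + y = 1 ∧
      x * polarBound θ c a + y * polarBound θ c b ≤ polarBound θ c φ := by
  have hlt : 0 < b - a := by linarith
  have h1 : (b - φ) / (b - a) + (φ - a) / (b - a) = 1 := by field_simp; ring
  have hx : 0 < (b - φ) / (b - a) := div_pos (by linarith) hlt
  have hy : 0 ≤ (φ - a) / (b - a) := div_nonneg (by linarith) hlt.le
  have hcomb : (b - φ) / (b - a) * a + (φ - a) / (b - a) * b = φ := by field_simp; ring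
  refine ⟨_, _, hx, hy, h1, ?_⟩
  set x := (b - φ) / (b - a)
  set y := (φ - a) / (b - a)
  have hcos := strictConcaveOn_cos_Icc.concaveOn.2 (x := a) (y := b)
    ⟨by linarith [Real.pi_pos], by linarith⟩ ⟨by linarith [Real.pi_pos], by linarith⟩ hx.le hy h1
  have hsin := strictConcaveOn_sin_Icc.concaveOn.2 (x := θ / 2 + a) (y := θ / 2 + b)
    ⟨by linarith [Real.pi_pos], by linarith⟩ ⟨by linarith [Real.pi_pos], by linarith⟩ hx.le hy h1
  simp only [smul_eq_mul] at hcos hsin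
  rw [hcomb] at hcos
  rw [show x * (θ / 2 + a) + y * (θ / 2 + b) = θ / 2 + φ by
    linear_combination θ / 2 * h1 + hcomb] at hsin
  have := mul_le_mul_of_nonneg_left hsin hc
  unfold polarBound
  linarith

lemma polarBound_le_of_mem_Ico {θ c a b φ : ℝ} (hθ0 : 0 ≤ θ) (hθ : θ ≤ Real.pi) (hc : 0 ≤ c)
    (ha : 0 ≤ a) (hb : b ≤ Real.pi / 2) (haφ : a ≤ φ) (hφb : φ < b)
    (hab : polarBound θ c a ≤ polarBound θ c b) : polarBound θ c a ≤ polarBound θ c φ := by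
  obtain ⟨x, y, -, hy, hxy, h⟩ := polarBound_concave hθ0 hθ hc ha hb haφ hφb
  calc polarBound θ c a = (x + y) * polarBound θ c a := by rw [hxy, one_mul]
    _ ≤ x * polarBound θ c a + y * polarBound θ c b := by
      linarith [mul_le_mul_of_nonneg_left hab hy]
    _ ≤ _ := h

/-- Monotonicity before a point whose value is at most a later value. -/
lemma polarBound_le_of_le {θ c a b φ : ℝ} (hθ0 : 0 ≤ θ) (hθ : θ ≤ Real.pi) (hc : 0 ≤ c) (ha : 0 ≤ a)
    (hb : b ≤ Real.pi / 2) (haφ : a ≤ φ) (hφb : φ < b)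
    (hφ : polarBound θ c φ ≤ polarBound θ c b) : polarBound θ c a ≤ polarBound θ c φ := by
  obtain ⟨x, y, hx, hy, hxy, h⟩ := polarBound_concave hθ0 hθ hc ha hb haφ hφb
  refine le_of_mul_le_mul_left ?_ hx
  have e : polarBound θ c φ = x * polarBound θ c φ + y * polarBound θ c φ := by
    rw [← add_mul, hxy, one_mul]
  linarith [mul_le_mul_of_nonneg_left hφ hy]

/-! ### Trigonometric estimates for at least seven cones. -/

lemma aperture_pos {m : ℕ} (hm : 7 ≤ m) : 0 < aperture m := by
  have : (7 : ℝ) ≤ m := by exact_mod_cast hm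
  unfold aperture
  have := Real.pi_pos
  positivity

lemma aperture_le {m : ℕ} (hm : 7 ≤ m) : 7 * aperture m ≤ 2 * Real.pi := by
  have h : (7 : ℝ) ≤ m := by exact_mod_cast hm
  have : m * aperture m = 2 * Real.pi := by unfold aperture; field_simp
  nlinarith [aperture_pos hm]

lemma sin_half_aperture_pos {m : ℕ} (hm : 7 ≤ m) : 0 < Real.sin (aperture m / 2) :=
  Real.sin_pos_of_pos_of_lt_pi (by linarith [aperture_pos hm])
    (by linarith [aperture_le hm, Real.pi_pos])

lemma cos_half_aperture_pos {m : ℕ} (hm : 7 ≤ m) : 0 < Real.cos (aperture m / 2) :=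
  Real.cos_pos_of_mem_Ioo ⟨by linarith [aperture_pos hm, Real.pi_pos],
    by linarith [aperture_le hm, Real.pi_pos]⟩

lemma tan_half_aperture_pos {m : ℕ} (hm : 7 ≤ m) : 0 < Real.tan (aperture m / 2) := by
  rw [Real.tan_eq_sin_div_cos]
  exact div_pos (sin_half_aperture_pos hm) (cos_half_aperture_pos hm)

/-- Equivalent to a half-aperture below π/6; this is what makes the chain edges shorter than uw. -/
lemma tan_half_aperture_sq_lt {m : ℕ} (hm : 7 ≤ m) : 3 * Real.tan (aperture m / 2) ^ 2 < 1 := by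
  have h : Real.tan (aperture m / 2) < Real.tan (Real.pi / 6) :=
    Real.tan_lt_tan_of_lt_of_lt_pi_div_two (by linarith [aperture_pos hm, Real.pi_pos])
      (by linarith [Real.pi_pos]) (by linarith [aperture_le hm, Real.pi_pos])
  have h0 := tan_half_aperture_pos hm
  rw [Real.tan_pi_div_six] at h
  have h3 : (1 / √3 : ℝ) ^ 2 = 1 / 3 := by rw [div_pow, Real.sq_sqrt (by norm_num)]; norm_num
  nlinarith

lemma sin_lt_cos {a b : ℝ} (ha : 0 ≤ a) (hab : a + b < Real.pi / 2) (hb : 0 ≤ b) :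
    Real.sin b < Real.cos a := by
  rw [← Real.cos_pi_div_two_sub]
  exact Real.cos_lt_cos_of_nonneg_of_le_pi_div_two ha (by linarith) (by linarith)

/-- The constant of the spanning ratio. -/
noncomputable def ratio (x : ℕ) (θ : ℝ) : ℝ :=
  if x = 4 then 1 / (Real.cos (θ / 2) - Real.sin (θ / 2))
  else Real.cos (θ / 4) / (Real.cos (θ / 2) - Real.sin (3 * θ / 4))

lemma one_le_ratio (x : ℕ) {θ : ℝ} (h0 : 0 < θ) (h1 : 7 * θ ≤ 2 * Real.pi) : 1 ≤ ratio x θ := by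
  unfold ratio
  split_ifs
  · have h : Real.sin (θ / 2) < Real.cos (θ / 2) :=
      sin_lt_cos (by linarith) (by linarith) (by linarith)
    rw [one_le_div (by linarith)]
    linarith [Real.cos_le_one (θ / 2),
      Real.sin_nonneg_of_nonneg_of_le_pi (x := θ / 2) (by linarith) (by linarith)]
  · have h : Real.sin (3 * θ / 4) < Real.cos (θ / 2) :=
      sin_lt_cos (by linarith) (by linarith) (by linarith)
    rw [one_le_div (by linarith)]
    linarith [Real.cos_le_cos_of_nonneg_of_le_pi (x := θ / 4) (y := θ / 2) (by linarith)
        (by linarith) (by linarith),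
      Real.sin_nonneg_of_nonneg_of_le_pi (x := 3 * θ / 4) (by linarith) (by linarith)]

/-! ### Moving to a cheaper cone. -/

lemma abs_sub_round_mul_le {δ : ℝ} (hδ : 0 < δ) (φ : ℝ) : |φ - round (φ / δ) * δ| ≤ δ / 2 := by
  have h := abs_sub_round (φ / δ)
  calc |φ - round (φ / δ) * δ| = |φ / δ - round (φ / δ)| * δ := by
        rw [← abs_of_pos hδ, ← abs_mul, abs_of_pos hδ]; congr 1; field_simp
    _ ≤ 1 / 2 * δ := by gcongr
    _ = δ / 2 := by ring

/-- For m = 4(k + 1) the bisectors include the perpendicular of any bisector. With β the distance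
from φ to the nearest bisector, c makes the values at β and π/2 - β equal, and concavity handles the
angles between them. -/
lemma exists_bisector_four {k : ℕ} {θ c φ : ℝ} (h0 : 0 < θ) (h1 : 7 * θ ≤ 2 * Real.pi)
    (hk : (k + 1) * θ = Real.pi / 2) (hc : c = ratio 4 θ) (hφ0 : 0 ≤ φ) (hφ : φ ≤ Real.pi / 2) :
    ∃ j : ℤ, |φ - j * θ| ≤ θ / 2 ∧ polarBound θ c |φ - j * θ| ≤ polarBound θ c φ := by
  refine ⟨round (φ / θ), abs_sub_round_mul_le h0 φ, ?_⟩
  have hj := abs_sub_round_mul_le h0 φ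
  set j := round (φ / θ)
  set β := |φ - j * θ| with hβ
  have hβ0 : 0 ≤ β := abs_nonneg _
  have hc0 : 0 ≤ c := by linarith [one_le_ratio 4 h0 h1]
  have heq : polarBound θ c β = polarBound θ c (Real.pi / 2 - β) := by
    have hd : Real.cos (θ / 2) - Real.sin (θ / 2) ≠ 0 := (sub_pos.2 <|
      sin_lt_cos (by linarith) (by linarith) (by linarith)).ne'
    have hc1 : c * (Real.cos (θ / 2) - Real.sin (θ / 2)) = 1 := by
      rw [hc, ratio, if_pos rfl, one_div_mul_cancel hd]
    rw [polarBound, polarBound, show θ / 2 + (Real.pi / 2 - β) = θ / 2 - β + Real.pi / 2 by ring,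
      Real.sin_add_pi_div_two, Real.cos_pi_div_two_sub, Real.cos_sub, Real.sin_add]
    linear_combination (Real.sin β - Real.cos β) * hc1
  have hβle := abs_le.1 hj
  rcases lt_trichotomy j 0 with hneg | hz | hpos
  · have : (j : ℝ) ≤ -1 := by exact_mod_cast (by omega : j ≤ -1)
    nlinarith
  · have : β = φ := by rw [hβ, hz]; simp [abs_of_nonneg hφ0]
    rw [this]
  · have hj1 : (1 : ℝ) ≤ j := by exact_mod_cast hpos
    have hφβ : β ≤ φ := by nlinarith
    -- For j ≤ k this follows from 2β ≤ θ and (k + 1)θ = π/2; for j = k + 1 it is an equality.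
    have hup : φ ≤ Real.pi / 2 - β := by
      rcases lt_trichotomy j (k + 1) with hlt | he | hgt
      · have : (j : ℝ) ≤ k := by exact_mod_cast (by omega : j ≤ k)
        have h2 : (j : ℝ) * θ ≤ k * θ := by gcongr
        have h3 : φ - j * θ ≤ β := le_abs_self _
        linarith
      · have : (j : ℝ) = k + 1 := by exact_mod_cast he
        have h3 : β = Real.pi / 2 - φ := by
          rw [hβ, this, hk, abs_of_nonpos (by linarith)]; ring
        linarith
      · have : (k : ℝ) + 2 ≤ j := by exact_mod_cast (by omega : (k : ℤ) + 2 ≤ j)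
        nlinarith
    rcases hup.eq_or_lt with h | h
    · rw [heq, ← h]
    · exact polarBound_le_of_mem_Ico h0.le (by linarith) hc0 hβ0 (by linarith) hφβ h heq.le

/-- For odd m the reversed bisectors halve the gaps between bisectors, so the cones of the two
endpoints together offer all multiples of θ/2, and some multiple is within θ/4. The constant c
equates the values at θ/4 and π/2; by concavity the bound increases up to θ/4 and stays above that
value afterwards. -/
lemma exists_bisector_odd {x : ℕ} {θ c φ : ℝ} (h0 : 0 < θ) (h1 : 7 * θ ≤ 2 * Real.pi)
    (hx : x ≠ 4) (hc : c = ratio x θ) (hφ0 : 0 ≤ φ) (hφ : φ ≤ Real.pi / 2) :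
    ∃ j : ℤ, |φ - j * (θ / 2)| ≤ θ / 4 ∧ polarBound θ c |φ - j * (θ / 2)| ≤ polarBound θ c φ := by
  have hj : |φ - round (φ / (θ / 2)) * (θ / 2)| ≤ θ / 4 := by
    convert abs_sub_round_mul_le (half_pos h0) φ using 1; ring
  refine ⟨round (φ / (θ / 2)), hj, ?_⟩
  set j := round (φ / (θ / 2))
  set β := |φ - j * (θ / 2)| with hβ
  have hβ0 : 0 ≤ β := abs_nonneg _
  have hc0 : 0 ≤ c := by linarith [one_le_ratio x h0 h1]
  have heq : polarBound θ c (θ / 4) = polarBound θ c (Real.pi / 2) := by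
    have hd : Real.cos (θ / 2) - Real.sin (3 * θ / 4) ≠ 0 := (sub_pos.2 <|
      sin_lt_cos (by linarith) (by linarith) (by linarith)).ne'
    have hc1 : c * (Real.cos (θ / 2) - Real.sin (3 * θ / 4)) = Real.cos (θ / 4) := by
      rw [hc, ratio, if_neg hx, div_mul_cancel₀ _ hd]
    rw [polarBound, polarBound, Real.sin_add_pi_div_two, Real.cos_pi_div_two,
      show θ / 2 + θ / 4 = 3 * θ / 4 by ring]
    linarith
  have hβle := abs_le.1 hj
  rcases lt_trichotomy j 0 with hneg | hz | hpos
  · have : (j : ℝ) ≤ -1 := by exact_mod_cast (by omega : j ≤ -1)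
    nlinarith
  · have : β = φ := by rw [hβ, hz]; simp [abs_of_nonneg hφ0]
    rw [this]
  · have hj1 : (1 : ℝ) ≤ j := by exact_mod_cast hpos
    have hφβ : θ / 4 ≤ φ := by nlinarith
    have hle : polarBound θ c β ≤ polarBound θ c (θ / 4) :=
      polarBound_le_of_le h0.le (by linarith) hc0 hβ0 le_rfl hj (by linarith) heq.le
    rcases hφ.eq_or_lt with rfl | h
    · rwa [← heq]
    · exact hle.trans
        (polarBound_le_of_mem_Ico h0.le (by linarith) hc0 (by linarith) le_rfl hφβ h heq.le)

lemma mem_cone_of_polar {m : ℕ} (hm : 7 ≤ m) {p q : Plane} {r ε : ℝ} {j : ℤ} (hr : 0 ≤ r)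
    (hε : |ε| ≤ aperture m / 2) (h : q - p = r • direction (j * aperture m + ε)) :
    q ∈ cone m p j := by
  rw [mem_cone_iff (sin_half_aperture_pos hm) (cos_half_aperture_pos hm), h, hgt_smul, lat_smul,
    hgt_direction, lat_direction, add_sub_cancel_left, abs_mul, abs_of_nonneg hr]
  have h7 := aperture_le hm
  have hpi := Real.pi_pos
  have hε' := abs_le.1 hε
  have hcos : 0 < Real.cos ε := Real.cos_pos_of_mem_Ioo ⟨by linarith, by linarith⟩
  have key : |Real.tan ε| ≤ Real.tan (aperture m / 2) := by
    rw [abs_le, ← Real.tan_neg]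
    exact ⟨Real.strictMonoOn_tan.monotoneOn ⟨by linarith, by linarith⟩
        ⟨by linarith, by linarith⟩ hε'.1,
      Real.strictMonoOn_tan.monotoneOn ⟨by linarith, by linarith⟩
        ⟨by linarith, by linarith⟩ hε'.2⟩
  rw [Real.tan_eq_sin_div_cos ε, abs_div, abs_of_pos hcos, div_le_iff₀ hcos] at key
  calc r * |Real.sin ε| ≤ r * (Real.tan (aperture m / 2) * Real.cos ε) := by gcongr
    _ = _ := by ring

lemma direction_add_pi (φ : ℝ) : direction (φ + Real.pi) = -direction φ := by
  apply plane_ext <;> simp [direction]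

/-- A displacement that points into the half-plane of a bisector is in some cone, of one of its two
endpoints, for which the path bound is no worse. -/
lemma exists_cheaper_cone {k x : ℕ} (hk : 1 ≤ k) (hx : x = 3 ∨ x = 4 ∨ x = 5) {c : ℝ}
    (hc : c = ratio x (aperture (4 * k + x))) {p q : Plane} {i : ℤ}
    (h : 0 ≤ hgt (i * aperture (4 * k + x)) (q - p)) :
    (∃ j : ℤ, q ∈ cone (4 * k + x) p j ∧
      pathBound (aperture (4 * k + x)) c (j * aperture (4 * k + x)) (q - p)
        ≤ pathBound (aperture (4 * k + x)) c (i * aperture (4 * k + x)) (q - p)) ∨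
    (∃ j : ℤ, p ∈ cone (4 * k + x) q j ∧
      pathBound (aperture (4 * k + x)) c (j * aperture (4 * k + x)) (p - q)
        ≤ pathBound (aperture (4 * k + x)) c (i * aperture (4 * k + x)) (q - p)) := by
  have hm : 7 ≤ 4 * k + x := by omega
  have h0 := aperture_pos hm
  have h1 := aperture_le hm
  have hcos := cos_half_aperture_pos hm
  have hmθ : ((4 * k + x : ℕ) : ℝ) * aperture (4 * k + x) = 2 * Real.pi := by
    have : ((4 * k + x : ℕ) : ℝ) ≠ 0 := by positivity
    unfold aperture; field_simp
  obtain ⟨r, φ, hr, hφ, hz⟩ := exists_polar (q - p) (i * aperture (4 * k + x)) h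
  have hpolar := pathBound_smul_direction (c := c) (i * aperture (4 * k + x)) hcos hr hφ
  have forward : ∀ (j : ℤ) (ε : ℝ), |ε| ≤ aperture (4 * k + x) / 2 →
      polarBound (aperture (4 * k + x)) c |ε| ≤ polarBound (aperture (4 * k + x)) c |φ| →
      j * aperture (4 * k + x) + ε = i * aperture (4 * k + x) + φ →
      (∃ j : ℤ, q ∈ cone (4 * k + x) p j ∧
        pathBound (aperture (4 * k + x)) c (j * aperture (4 * k + x)) (q - p)
          ≤ pathBound (aperture (4 * k + x)) c (i * aperture (4 * k + x)) (q - p)) := by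
    intro j ε hε hb he
    refine ⟨j, mem_cone_of_polar hm hr hε (by rw [hz, he]), ?_⟩
    rw [hz, hpolar, ← he, pathBound_smul_direction _ hcos hr (by linarith)]
    gcongr
  have backward : ∀ (j : ℤ) (ε : ℝ), |ε| ≤ aperture (4 * k + x) / 2 →
      polarBound (aperture (4 * k + x)) c |ε| ≤ polarBound (aperture (4 * k + x)) c |φ| →
      j * aperture (4 * k + x) + ε = i * aperture (4 * k + x) + φ + Real.pi →
      (∃ j : ℤ, p ∈ cone (4 * k + x) q j ∧
        pathBound (aperture (4 * k + x)) c (j * aperture (4 * k + x)) (p - q)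
          ≤ pathBound (aperture (4 * k + x)) c (i * aperture (4 * k + x)) (q - p)) := by
    intro j ε hε hb he
    have hz' : p - q = r • direction (j * aperture (4 * k + x) + ε) := by
      rw [he, direction_add_pi, smul_neg, ← hz, neg_sub]
    refine ⟨j, mem_cone_of_polar hm hr hε hz', ?_⟩
    rw [hz', hz, hpolar, pathBound_smul_direction _ hcos hr (by linarith)]
    gcongr
  by_cases hx4 : x = 4
  · subst hx4
    have hk' : ((k : ℝ) + 1) * aperture (4 * k + 4) = Real.pi / 2 := by
      push_cast at hmθ; linarith
    obtain ⟨j, hj, hb⟩ := exists_bisector_four h0 h1 hk' hc (abs_nonneg φ) hφ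
    left
    rcases abs_cases φ with ⟨e, -⟩ | ⟨e, -⟩
    · refine forward (i + j) _ hj hb ?_
      rw [e]; push_cast; ring
    · refine forward (i - j) (-(|φ| - j * aperture (4 * k + 4))) (by rwa [abs_neg])
        (by rwa [abs_neg]) ?_
      rw [e]; push_cast; ring
  · obtain ⟨j, hj, hb⟩ := exists_bisector_odd h0 h1 hx4 hc (abs_nonneg φ) hφ
    obtain ⟨n, hn⟩ : ∃ n : ℕ, 4 * k + x = 2 * n + 1 := by
      rcases hx with rfl | rfl | rfl
      · exact ⟨2 * k + 1, by ring⟩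
      · exact absurd rfl hx4
      · exact ⟨2 * k + 2, by ring⟩
    have hn' : ((n : ℝ) + 1 / 2) * aperture (4 * k + x) = Real.pi := by
      have : ((4 * k + x : ℕ) : ℝ) = 2 * n + 1 := by exact_mod_cast hn
      rw [this] at hmθ
      linarith
    have hj' : |-(|φ| - j * (aperture (4 * k + x) / 2))| ≤ aperture (4 * k + x) / 2 := by
      rw [abs_neg]; linarith
    -- Even multiples of θ/2 are bisectors at p. An odd multiple becomes a bisector at q after
    -- adding π = (n + 1/2)θ.
    rcases Int.even_or_odd' j with ⟨l, rfl | rfl⟩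
    · left
      rcases abs_cases φ with ⟨e, -⟩ | ⟨e, -⟩
      · refine forward (i + l) _ (by linarith) hb ?_
        rw [e]; push_cast; ring
      · refine forward (i - l) _ hj' (by rwa [abs_neg]) ?_
        rw [e]; push_cast; ring
    · right
      rcases abs_cases φ with ⟨e, -⟩ | ⟨e, -⟩
      · refine backward (i + n + l + 1) _ (by linarith) hb ?_
        rw [e, ← hn']; push_cast; ring
      · refine backward (i + n - l) _ hj' (by rwa [abs_neg]) ?_
        rw [e, ← hn']; push_cast; ring

/-! ### Paths and their lengths. -/

/-- Some path from `u` to `w` in the graph has length at most `L`. -/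
def Reach {P : Finset Plane} (G : SimpleGraph P) (u w : P) (L : ℝ) : Prop :=
  ∃ p : G.Walk u w, p.IsPath ∧ walkLength p ≤ L

/-- Removing the loops of a walk does not lengthen it, so walks may be concatenated freely. -/
lemma reach_of_walk {P : Finset Plane} {G : SimpleGraph P} {u w : P} (p : G.Walk u w) :
    Reach G u w (walkLength p) := by
  classical
  refine ⟨p.bypass, p.bypass_isPath, ?_⟩
  unfold walkLength
  refine (p.darts_bypass_sublist_darts.map _).sum_le_sum ?_
  intro a ha
  obtain ⟨d, -, rfl⟩ := List.mem_map.1 ha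
  exact dist_nonneg

lemma Reach.mono {P : Finset Plane} {G : SimpleGraph P} {u w : P} {L L' : ℝ}
    (h : Reach G u w L) (hL : L ≤ L') : Reach G u w L' :=
  let ⟨p, hp, hl⟩ := h
  ⟨p, hp, hl.trans hL⟩

lemma Reach.trans {P : Finset Plane} {G : SimpleGraph P} {u v w : P} {L L' : ℝ}
    (h : Reach G u v L) (h' : Reach G v w L') : Reach G u w (L + L') := by
  obtain ⟨p, -, hl⟩ := h
  obtain ⟨q, -, hl'⟩ := h'
  refine (reach_of_walk (p.append q)).mono ?_
  unfold walkLength at *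
  rw [SimpleGraph.Walk.darts_append, List.map_append, List.sum_append]
  exact add_le_add hl hl'

lemma Reach.symm {P : Finset Plane} {G : SimpleGraph P} {u w : P} {L : ℝ}
    (h : Reach G u w L) : Reach G w u L := by
  obtain ⟨p, -, hl⟩ := h
  refine (reach_of_walk p.reverse).mono (le_of_eq_of_le ?_ hl)
  unfold walkLength
  rw [SimpleGraph.Walk.darts_reverse, List.map_reverse, List.map_map, List.sum_reverse]
  congr 2
  funext d
  exact dist_comm _ _

lemma reach_of_adj {P : Finset Plane} {G : SimpleGraph P} {u w : P} (h : G.Adj u w) :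
    Reach G u w (dist (u : Plane) w) := by
  refine (reach_of_walk (.cons h .nil)).mono (le_of_eq ?_)
  simp [walkLength]

/-! ### The convex chain. -/

/-- The length of the path along the two sides of a canonical triangle through the corner on the
side determined by the sign `σ`, the second one weighted by `c`. -/
noncomputable def sideBound (θ c ψ σ : ℝ) (z : Plane) : ℝ :=
  hgt ψ z / Real.cos (θ / 2) + c * (hgt ψ z * Real.tan (θ / 2) + σ * lat ψ z)

lemma sideBound_add (θ c ψ σ : ℝ) (z z' : Plane) :
    sideBound θ c ψ σ (z + z') = sideBound θ c ψ σ z + sideBound θ c ψ σ z' := by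
  simp only [sideBound, hgt_add, lat_add]
  ring

lemma sideBound_le_pathBound {θ c ψ σ : ℝ} (hc : 0 ≤ c) (hσ : |σ| = 1) (z : Plane) :
    sideBound θ c ψ σ z ≤ pathBound θ c ψ z := by
  have : σ * lat ψ z ≤ |lat ψ z| := (le_abs_self _).trans (by rw [abs_mul, hσ, one_mul])
  unfold sideBound pathBound
  gcongr

lemma pathBound_eq_sideBound {θ c ψ σ : ℝ} (hσ : |σ| = 1) {z : Plane} (h : 0 ≤ σ * lat ψ z) :
    pathBound θ c ψ z = sideBound θ c ψ σ z := by
  rw [pathBound, sideBound, ← abs_of_nonneg h, abs_mul, hσ, one_mul]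

/-- An edge of the convex chain in the triangle spanned by two vectors of a cone is shorter than
the second vector. -/
lemma chain_edge_sq_lt {t hv lv H L g r : ℝ} (ht : 3 * t ^ 2 < 1) (ht0 : 0 < t)
    (hhv : 0 < hv) (hlv : |lv| ≤ t * hv) (hH : 0 < H) (hL : |L| ≤ t * H) (hg : 0 < g) (hr : 0 ≤ r)
    (hr1 : r ≤ 1) (hp : g * hv ≤ r * H) :
    (r * H - g * hv) ^ 2 + (r * L - g * lv) ^ 2 < H ^ 2 + L ^ 2 := by
  have h1 : |L * lv| ≤ t * H * (t * hv) := by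
    rw [abs_mul]; gcongr
  have h2 : lv ^ 2 ≤ (t * hv) ^ 2 := sq_le_sq' (abs_le.1 hlv).1 (abs_le.1 hlv).2
  have h3 : g * hv * (g * hv) ≤ r * H * (g * hv) := by gcongr
  have h4 : 0 < g * hv * (g * hv) := by positivity
  have h5 := (abs_le.1 h1).1
  have h6 : 0 ≤ (1 - r ^ 2) * (H ^ 2 + L ^ 2) := by
    have : 0 ≤ 1 - r ^ 2 := by nlinarith
    positivity
  have h7 : g ^ 2 * lv ^ 2 ≤ g ^ 2 * (t * hv) ^ 2 := by gcongr
  have h8 : 2 * (r * g) * (-(t * H * (t * hv))) ≤ 2 * (r * g) * (L * lv) := by gcongr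
  have h9 : (1 - t ^ 2) * (g * hv * (g * hv)) ≤ (1 - t ^ 2) * (r * H * (g * hv)) :=
    mul_le_mul_of_nonneg_left h3 (by nlinarith)
  -- Expanding |r w - g v|² with v and w in the cone gives at most r²|w|² - (1 - 3t²)(g hv)².
  have h10 : 0 < (1 - 3 * t ^ 2) * (g * hv * (g * hv)) := mul_pos (by linarith) h4
  nlinarith

lemma wellFounded_of_real {α : Type*} [Finite α] (f : α → ℝ) :
    WellFounded fun a b => f a < f b := by
  have : IsTrans α fun a b => f a < f b := ⟨fun _ _ _ h h' => lt_trans h h'⟩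
  have : Std.Irrefl fun a b : α => f a < f b := ⟨fun a => lt_irrefl (f a)⟩
  exact Finite.wellFounded_of_trans_of_irrefl _

/-- Following the convex chain from `v` to `w` in the triangle `uvw`. -/
lemma reach_of_chain {m : ℕ} (hm : 7 ≤ m) {P : Finset Plane} {S : SimpleGraph P}
    (G : SimpleGraph P) (hP : NoThreeCollinear P) (hS : PlanarConstraints S) {u w : P}
    {c ψ σ : ℝ} (hc : 0 ≤ c) (hσ : |σ| = 1)
    (hne : ∀ p q : P, p ≠ q → hgt ψ ((q : Plane) - p) ≠ 0)
    (hedge : ∀ p q : P, (visibilityGraph S).Adj p q → dist (p : Plane) q < dist (u : Plane) w →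
      0 ≤ hgt ψ ((q : Plane) - p) → Reach G p q (pathBound (aperture m) c ψ ((q : Plane) - p)))
    (huw : (visibilityGraph S).Adj u w)
    (hw : |lat ψ ((w : Plane) - u)| ≤ Real.tan (aperture m / 2) * hgt ψ ((w : Plane) - u)) :
    ∀ v : P, (visibilityGraph S).Adj u v →
      0 < σ * cr ((v : Plane) - u) ((w : Plane) - u) →
      |lat ψ ((v : Plane) - u)| ≤ Real.tan (aperture m / 2) * hgt ψ ((v : Plane) - u) →
      (∀ q : P, S.Adj u q → ¬ (0 < bcl (u : Plane) v w q ∧ 0 < bcr (u : Plane) v w q)) →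
      (∀ z : P, (visibilityGraph S).Adj u z → 0 ≤ bcl (u : Plane) v w z →
        0 ≤ bcr (u : Plane) v w z → bcl (u : Plane) v w z + bcr (u : Plane) v w z ≤ 1 →
        0 ≤ hgt ψ ((z : Plane) - v)) →
      (Reach G u v (sideBound (aperture m) c ψ σ ((v : Plane) - u)) ∨
        (Reach G u v (sideBound (aperture m) c ψ (-σ) ((v : Plane) - u)) ∧
          ∀ z : P, z ≠ u → 0 ≤ bcl (u : Plane) v w z → 0 ≤ bcr (u : Plane) v w z →
            bcl (u : Plane) v w z + bcr (u : Plane) v w z ≤ 1 →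
            σ * lat ψ ((z : Plane) - v) ≤ 0)) →
      Reach G u w (pathBound (aperture m) c ψ ((w : Plane) - u)) := by
  set θ := aperture m with hθ
  set t := Real.tan (θ / 2) with ht
  have ht0 : 0 < t := tan_half_aperture_pos hm
  have ht3 : 3 * t ^ 2 < 1 := tan_half_aperture_sq_lt hm
  have hσ2 : σ ^ 2 = 1 := by rw [← sq_abs, hσ, one_pow]
  have hσ' : |-σ| = 1 := by rw [abs_neg, hσ]
  have hpos : ∀ v : P, u ≠ v →
      |lat ψ ((v : Plane) - u)| ≤ t * hgt ψ ((v : Plane) - u) → 0 < hgt ψ ((v : Plane) - u) := by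
    intro v huv hv
    have h0 := nonneg_of_mul_nonneg_right ((abs_nonneg _).trans hv) ht0
    exact h0.lt_of_ne (hne u v huv).symm
  intro v
  -- The chain climbs along the bisector, so the current vertex can be replaced by the next one. The
  -- last alternative of the hypotheses is the invariant: the chain has not turned back, or it has
  -- and everything left lies on the `-σ` side of v.
  induction v using (wellFounded_of_real fun v : P => -hgt ψ (v : Plane)).induction with
  | _ v ih =>
  intro huv hcr hv hcon hlow hreach
  have hvw : v ≠ w := by
    rintro rfl
    simp [cr] at hcr
    linarith [hcr]
  have hD := hP u v w huv.1 hvw huw.1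
  obtain ⟨y, hyu, hyv, huy, hvy, hs0, ht'0, hst, hyw, hfar⟩ := exists_next hP hS huv huw hvw hcon
  set s := bcl (u : Plane) v w y with hs
  set r := bcr (u : Plane) v w y with hr
  have hy : (y : Plane) - u = s • ((v : Plane) - u) + r • ((w : Plane) - u) :=
    sub_eq_iff_eq_add'.2 (eq_frame hD y)
  have hhv := hpos v huv.1 hv
  have hH := hpos w huw.1 hw
  set hV := hgt ψ ((v : Plane) - u) with hhV
  set lV := lat ψ ((v : Plane) - u) with hlV
  set H := hgt ψ ((w : Plane) - u) with hhW
  set L := lat ψ ((w : Plane) - u) with hlW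
  have hcr' : 0 < σ * (hV * L - lV * H) := by rwa [cr_eq ψ] at hcr
  have frame : ∀ z : Plane, z - u = bcl (u : Plane) v w z • ((v : Plane) - u)
      + bcr (u : Plane) v w z • ((w : Plane) - u) := fun z =>
    sub_eq_iff_eq_add'.2 (eq_frame hD z)
  have hgtu : ∀ z : Plane, hgt ψ (z - u) = bcl (u : Plane) v w z * hV + bcr (u : Plane) v w z * H :=
    fun z => by rw [frame z, hgt_add, hgt_smul, hgt_smul]
  have latu : ∀ z : Plane, lat ψ (z - u) = bcl (u : Plane) v w z * lV + bcr (u : Plane) v w z * L :=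
    fun z => by rw [frame z, lat_add, lat_smul, lat_smul]
  have sub_u : ∀ z z' : Plane, z - z' = (z - u) - (z' - u) := fun z z' => by abel
  have hgt_vy : hgt ψ ((y : Plane) - v) = r * H - (1 - s) * hV := by
    rw [sub_u, hgt_sub, hgtu y]; ring
  have lat_vy : lat ψ ((y : Plane) - v) = r * L - (1 - s) * lV := by
    rw [sub_u, lat_sub, latu y]; ring
  have hg : 0 < 1 - s := by linarith
  have hp0 : 0 < hgt ψ ((y : Plane) - v) :=
    (hlow y huy hs0 ht'0.le hst).lt_of_ne (hne v y hyv.symm).symm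
  have hdist : dist (v : Plane) y < dist (u : Plane) w := by
    rw [dist_comm, dist_comm (u : Plane), dist_eq_norm, dist_eq_norm]
    refine lt_of_pow_lt_pow_left₀ 2 (norm_nonneg _) ?_
    rw [norm_sq_eq ψ, norm_sq_eq ψ, hgt_vy, lat_vy]
    exact chain_edge_sq_lt ht3 ht0 hhv hv hH hw hg ht'0.le (by linarith) (by linarith)
  have hreach_vy := hedge v y hvy hdist hp0.le
  -- the triangle spanned by `y` and `w` lies in the triangle spanned by `v` and `w`
  have sub_tri : y ≠ w → ∀ z : Plane, bcl (u : Plane) v w z = bcl (u : Plane) y w z * s ∧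
      bcr (u : Plane) v w z = bcl (u : Plane) y w z * r + bcr (u : Plane) y w z := by
    intro hyw' z
    have hDy := hP u y w huy.1 hyw' huw.1
    have hz : z = u + ((bcl (u : Plane) y w z * s) • ((v : Plane) - u)
        + (bcl (u : Plane) y w z * r + bcr (u : Plane) y w z) • ((w : Plane) - u)) := by
      conv_lhs => rw [eq_frame hDy z, frame y]
      module
    constructor
    · conv_lhs => rw [hz, bcl_frame hD]
    · conv_lhs => rw [hz, bcr_frame hD]
  have in_tri : y ≠ w → ∀ z : Plane, 0 ≤ bcl (u : Plane) y w z → 0 ≤ bcr (u : Plane) y w z →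
      bcl (u : Plane) y w z + bcr (u : Plane) y w z ≤ 1 →
      0 ≤ bcl (u : Plane) v w z ∧ 0 ≤ bcr (u : Plane) v w z ∧
        bcl (u : Plane) v w z + bcr (u : Plane) v w z ≤ 1 := by
    intro hyw' z h1 h2 h3
    obtain ⟨e1, e2⟩ := sub_tri hyw' z
    rw [e1, e2]
    refine ⟨by positivity, by positivity, ?_⟩
    nlinarith [mul_nonneg h1 (sub_nonneg.2 hst)]
  -- the remaining vertices lie beyond the line `vy`
  have beyond : y ≠ w → ∀ z : P, z ≠ u → 0 ≤ bcl (u : Plane) y w z → 0 ≤ bcr (u : Plane) y w z →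
      bcl (u : Plane) y w z + bcr (u : Plane) y w z ≤ 1 →
      ∃ p q : ℝ, 0 ≤ p ∧ 0 ≤ q ∧
        r * hgt ψ ((z : Plane) - y) = p * hgt ψ ((y : Plane) - v) + q * hgt ψ ((y : Plane) - u) ∧
        r * lat ψ ((z : Plane) - y)
          = p * lat ψ ((y : Plane) - v) + q * lat ψ ((y : Plane) - u) := by
    intro hyw' z hzu h1 h2 h3
    obtain ⟨e1, e2⟩ := sub_tri hyw' z
    obtain ⟨i1, i2, i3⟩ := in_tri hyw' z h1 h2 h3
    have hq := hfar z hzu i1 i2 i3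
    -- So z - y is in the cone spanned by y - v and y - u: the chain turns away from u at y.
    -- Non-negativity of the second coefficient is the emptiness of the near side of vy.
    refine ⟨s * bcr (u : Plane) y w z, bcl (u : Plane) v w z * r
      + bcr (u : Plane) v w z * (1 - s) - r, by positivity, by linarith, ?_, ?_⟩
    · rw [hgt_vy, sub_u z y, hgt_sub, hgtu z, hgtu y, ← hs, ← hr, e1, e2]
      ring
    · rw [lat_vy, sub_u z y, lat_sub, latu z, latu y, ← hs, ← hr, e1, e2]
      ring
  -- once an edge turns to the side of `v`, everything is on that side
  have turn : σ * lat ψ ((y : Plane) - v) ≤ 0 → σ * L ≤ 0 ∧ σ * lV ≤ 0 := by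
    intro h
    rw [lat_vy] at h
    rw [hgt_vy] at hp0
    have hL : σ * L ≤ 0 := by
      by_contra! hL
      have h1 : r * (σ * L) * hV ≤ (1 - s) * (σ * lV) * hV :=
        mul_le_mul_of_nonneg_right (by linarith) hhv.le
      have h2 : (1 - s) * (σ * lV * H) < (1 - s) * (σ * L * hV) :=
        mul_lt_mul_of_pos_left (by linarith) hg
      have h3 : (1 - s) * hV * (σ * L) < r * H * (σ * L) :=
        mul_lt_mul_of_pos_right (by linarith) hL
      have h4 : (1 - s) * (σ * lV * H) * hV < r * (σ * L) * H * hV := by nlinarith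
      have h5 : r * (σ * L) * hV * H ≤ (1 - s) * (σ * lV) * hV * H :=
        mul_le_mul_of_nonneg_right h1 hH.le
      linarith
    refine ⟨hL, ?_⟩
    by_contra! hlV
    have := mul_pos hlV hH
    have := mul_nonpos_of_nonpos_of_nonneg hL hhv.le
    linarith
  have new : Reach G u y (sideBound θ c ψ σ ((y : Plane) - u)) ∨
      (Reach G u y (sideBound θ c ψ (-σ) ((y : Plane) - u)) ∧
        (y ≠ w → ∀ z : P, z ≠ u → 0 ≤ bcl (u : Plane) y w z → 0 ≤ bcr (u : Plane) y w z →
          bcl (u : Plane) y w z + bcr (u : Plane) y w z ≤ 1 →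
          σ * lat ψ ((z : Plane) - y) ≤ 0)) := by
    have hadd : ∀ σ, sideBound θ c ψ σ ((y : Plane) - u) = sideBound θ c ψ σ ((v : Plane) - u)
        + sideBound θ c ψ σ ((y : Plane) - v) := fun σ => by
      rw [← sideBound_add]; congr 1; abel
    have leftCase : Reach G u v (sideBound θ c ψ (-σ) ((v : Plane) - u)) →
        σ * lat ψ ((y : Plane) - v) ≤ 0 →
        (Reach G u y (sideBound θ c ψ (-σ) ((y : Plane) - u)) ∧
        (y ≠ w → ∀ z : P, z ≠ u → 0 ≤ bcl (u : Plane) y w z → 0 ≤ bcr (u : Plane) y w z →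
          bcl (u : Plane) y w z + bcr (u : Plane) y w z ≤ 1 →
          σ * lat ψ ((z : Plane) - y) ≤ 0)) := by
      intro h1 h2
      rw [pathBound_eq_sideBound hσ' (by linarith)] at hreach_vy
      refine ⟨hadd _ ▸ h1.trans hreach_vy, fun hyw' z hzu i1 i2 i3 => ?_⟩
      obtain ⟨p, q, hp, hq, -, e⟩ := beyond hyw' z hzu i1 i2 i3
      obtain ⟨hL, hlV⟩ := turn h2
      have hyl : σ * lat ψ ((y : Plane) - u) ≤ 0 := by
        rw [latu y]
        have := mul_nonpos_of_nonneg_of_nonpos hs0 hlV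
        have := mul_nonpos_of_nonneg_of_nonpos ht'0.le hL
        linarith
      have := mul_nonpos_of_nonneg_of_nonpos hp h2
      have := mul_nonpos_of_nonneg_of_nonpos hq hyl
      refine nonpos_of_mul_nonpos_right (a := r) ?_ ht'0
      calc r * (σ * lat ψ ((z : Plane) - y)) = σ * (r * lat ψ ((z : Plane) - y)) := by ring
        _ ≤ 0 := by rw [e]; linarith
    rcases hreach with h | ⟨h, hall⟩
    · rcases le_total 0 (σ * lat ψ ((y : Plane) - v)) with h' | h'
      · rw [pathBound_eq_sideBound hσ h'] at hreach_vy
        exact Or.inl (hadd _ ▸ h.trans hreach_vy)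
      -- The chain turns back here. By `turn`, v is on the `-σ` side of the bisector, so the bound
      -- with `-σ` is the weaker one for uv.
      · refine Or.inr (leftCase (h.mono ?_) h')
        have := mul_nonpos_of_nonneg_of_nonpos hc (turn h').2
        unfold sideBound
        rw [← hlV]
        linarith
    · exact Or.inr (leftCase h (hall y hyu hs0 ht'0.le hst))
  by_cases hyw' : y = w
  · subst hyw'
    rcases new with h | ⟨h, -⟩
    · exact h.mono (sideBound_le_pathBound hc hσ _)
    · exact h.mono (sideBound_le_pathBound hc hσ' _)
  have hs1 := hyw.resolve_left hyw'
  refine ih y ?_ huy ?_ ?_ ?_ ?_ (new.imp_right fun h => ⟨h.1, h.2 hyw'⟩)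
  · rw [hgt_sub] at hp0
    linarith
  · rw [cr_eq ψ, hgtu y, latu y, ← hhW, ← hlW, ← hs, ← hr]
    have := mul_pos hs1 hcr'
    linarith
  · rw [hgtu y, latu y, ← hs, ← hr]
    calc |s * lV + r * L| ≤ |s * lV| + |r * L| := abs_add_le _ _
      _ = s * |lV| + r * |L| := by rw [abs_mul, abs_mul, abs_of_nonneg hs0, abs_of_pos ht'0]
      _ ≤ s * (t * hV) + r * (t * H) := by gcongr
      _ = _ := by ring
  · rintro q hq ⟨h1, h2⟩
    obtain ⟨e1, e2⟩ := sub_tri hyw' q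
    apply hcon q hq
    rw [e1, e2]
    exact ⟨by positivity, by positivity⟩
  · intro z huz h1 h2 h3
    obtain ⟨p, q, hp, hq, e, -⟩ := beyond hyw' z huz.1.symm h1 h2 h3
    refine nonneg_of_mul_nonneg_right (a := r) ?_ ht'0
    rw [e, hgtu y, ← hs, ← hr]
    positivity

/-! ### Wedges and subcones. -/

/-- `d` points into the cone with bisector `direction ψ` and half-aperture `arctan t`. -/
def InWedge (t ψ : ℝ) (d : Plane) : Prop := |lat ψ d| ≤ t * hgt ψ d

lemma InWedge.add {t ψ : ℝ} {d d' : Plane} (h : InWedge t ψ d) (h' : InWedge t ψ d') :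
    InWedge t ψ (d + d') := by
  unfold InWedge at *
  rw [hgt_add, lat_add]
  linarith [abs_add_le (lat ψ d) (lat ψ d')]

lemma InWedge.smul {t ψ r : ℝ} {d : Plane} (h : InWedge t ψ d) (hr : 0 ≤ r) :
    InWedge t ψ (r • d) := by
  unfold InWedge at *
  rw [hgt_smul, lat_smul, abs_mul, abs_of_nonneg hr]
  nlinarith [mul_le_mul_of_nonneg_left h hr]

/-- The triangle inequality through a corner of the canonical triangle, with c ≥ 1; it bounds the
first edge uv for either sign. -/
lemma norm_le_sideBound {m : ℕ} (hm : 7 ≤ m) {c ψ σ : ℝ} (hc : 1 ≤ c) (hσ : |σ| = 1) {z : Plane}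
    (hz : InWedge (Real.tan (aperture m / 2)) ψ z) : ‖z‖ ≤ sideBound (aperture m) c ψ σ z := by
  have hcos := cos_half_aperture_pos hm
  have ht0 := tan_half_aperture_pos hm
  have hsec : (1 / Real.cos (aperture m / 2)) ^ 2 = 1 + Real.tan (aperture m / 2) ^ 2 := by
    rw [Real.tan_eq_sin_div_cos]
    field_simp
    exact (Real.cos_sq_add_sin_sq _).symm
  have hsec0 : 0 < 1 / Real.cos (aperture m / 2) := by positivity
  unfold InWedge at hz
  have hh : 0 ≤ hgt ψ z := nonneg_of_mul_nonneg_right ((abs_nonneg _).trans hz) ht0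
  have hl : |σ * lat ψ z| ≤ Real.tan (aperture m / 2) * hgt ψ z := by
    rwa [abs_mul, hσ, one_mul]
  have hl2 : (σ * lat ψ z) ^ 2 = lat ψ z ^ 2 := by rw [mul_pow, ← sq_abs σ, hσ]; ring
  unfold sideBound
  rw [div_eq_mul_one_div]
  set h := hgt ψ z
  set l := σ * lat ψ z with hldef
  set t := Real.tan (aperture m / 2)
  set e := 1 / Real.cos (aperture m / 2)
  have hX : 0 ≤ h * t + l := by linarith [(abs_le.1 hl).1]
  have h1 : ‖z‖ ^ 2 ≤ (h * e + (h * t + l)) ^ 2 := by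
    rw [norm_sq_eq ψ z, ← hl2]
    have h2 : 0 ≤ (h * t + l) * (h * (e + t)) := by positivity
    nlinarith
  have h3 : ‖z‖ ≤ h * e + (h * t + l) := (sq_le_sq₀ (norm_nonneg _) (by positivity)).1 h1
  nlinarith [mul_nonneg (sub_nonneg.2 hc) hX]

lemma dist_bisectorProj (m : ℕ) (u v : Plane) (i : ℤ) :
    dist u (bisectorProj m u i v) = |hgt (i * aperture m) (v - u)| := by
  have hn : ‖direction (i * aperture m)‖ = 1 := by
    rw [← sq_eq_sq₀ (norm_nonneg _) zero_le_one, norm_sq_eq (i * aperture m), hgt_direction,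
      lat_direction]
    simp
  rw [bisectorProj, dist_self_add_right, norm_smul, bisector, hn, mul_one, inner_direction,
    Real.norm_eq_abs]

lemma mem_sector_of_cr {u d₁ d₂ z : Plane} (h : 0 < cr d₁ d₂) (h₁ : 0 ≤ cr d₁ (z - u))
    (h₂ : 0 ≤ cr (z - u) d₂) : z ∈ sector u d₁ d₂ := by
  refine ⟨cr (z - u) d₂ / cr d₁ d₂, cr d₁ (z - u) / cr d₁ d₂, by positivity, by positivity, ?_⟩
  apply plane_ext <;> simp only [PiLp.add_apply, PiLp.smul_apply, smul_eq_mul] <;>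
    field_simp <;> simp only [cr, PiLp.sub_apply] <;> ring

lemma sector_combo {u d₁ d₂ v w z : Plane} {a b : ℝ} (ha : 0 ≤ a) (hb : 0 ≤ b)
    (hv : v ∈ sector u d₁ d₂) (hw : w ∈ sector u d₁ d₂)
    (hz : z - u = a • (v - u) + b • (w - u)) : z ∈ sector u d₁ d₂ := by
  obtain ⟨s, t, hs, ht, rfl⟩ := hv
  obtain ⟨s', t', hs', ht', rfl⟩ := hw
  refine ⟨a * s + b * s', a * t + b * t', by positivity, by positivity, ?_⟩
  rw [sub_eq_iff_eq_add'.1 hz]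
  module

section Subcone

variable {m : ℕ} {P : Finset Plane} {S : SimpleGraph P} {u : P} {i : ℤ}

lemma inWedge_of_mem_cone (hm : 7 ≤ m) {u p : Plane} (h : p ∈ cone m u i) :
    InWedge (Real.tan (aperture m / 2)) (i * aperture m) (p - u) :=
  (mem_cone_iff (sin_half_aperture_pos hm) (cos_half_aperture_pos hm) u p i).1 h

lemma leftRay_eq (m : ℕ) (i : ℤ) : leftRay m i = direction (i * aperture m + -(aperture m / 2)) := by
  unfold leftRay; ring_nf

lemma rightRay_eq (m : ℕ) (i : ℤ) : rightRay m i = direction (i * aperture m + aperture m / 2) := by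
  unfold rightRay; ring_nf

lemma finite_divider (m : ℕ) (S : SimpleGraph P) (u : P) (i : ℤ) :
    {d | IsDivider m S u i d}.Finite := by
  refine Set.Finite.subset (((Set.finite_range fun q : P => (q : Plane) - u).insert
    (rightRay m i)).insert (leftRay m i)) ?_
  rintro d (h | h | ⟨q, -, -, h⟩)
  · exact Or.inl h
  · exact Or.inr (Or.inl h)
  · exact Or.inr (Or.inr ⟨q, h.symm⟩)

lemma IsDivider.inWedge (hm : 7 ≤ m) {d : Plane} (h : IsDivider m S u i d)
    (hperp : ∀ q : P, u ≠ q → hgt (i * aperture m) ((q : Plane) - u) ≠ 0) :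
    InWedge (Real.tan (aperture m / 2)) (i * aperture m) d ∧ 0 < hgt (i * aperture m) d := by
  have hs := sin_half_aperture_pos hm
  have hc := cos_half_aperture_pos hm
  unfold InWedge
  rcases h with rfl | rfl | ⟨q, hq, hqc, rfl⟩
  · rw [leftRay_eq, hgt_direction, lat_direction, add_sub_cancel_left, Real.cos_neg, Real.sin_neg,
      abs_neg, abs_of_pos hs, Real.tan_mul_cos hc.ne']
    exact ⟨le_rfl, hc⟩
  · rw [rightRay_eq, hgt_direction, lat_direction, add_sub_cancel_left, abs_of_pos hs,
      Real.tan_mul_cos hc.ne']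
    exact ⟨le_rfl, hc⟩
  · have h := inWedge_of_mem_cone hm hqc
    refine ⟨h, lt_of_le_of_ne ?_ (hperp q hq.ne).symm⟩
    exact nonneg_of_mul_nonneg_right ((abs_nonneg _).trans h) (tan_half_aperture_pos hm)

/-- A vertex of a cone lies in one of the subcones. -/
lemma exists_subcone (hm : 7 ≤ m) (hgp : GeneralPosition m P) {w : P} (huw : u ≠ w)
    (hperp : ∀ q : P, u ≠ q → hgt (i * aperture m) ((q : Plane) - u) ≠ 0)
    (hw : (w : Plane) ∈ cone m u i) :
    ∃ d₁ d₂ : Plane, IsDivider m S u i d₁ ∧ IsDivider m S u i d₂ ∧ Clockwise d₁ d₂ ∧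
      (∀ d, IsDivider m S u i d → ¬ (Clockwise d₁ d ∧ Clockwise d d₂)) ∧
      (w : Plane) ∈ sector u d₁ d₂ := by
  have hs := sin_half_aperture_pos hm
  have hc := cos_half_aperture_pos hm
  have hz := inWedge_of_mem_cone hm hw
  have ht0 := tan_half_aperture_pos hm
  have hz0 : 0 < hgt (i * aperture m) ((w : Plane) - u) :=
    lt_of_le_of_ne (nonneg_of_mul_nonneg_right ((abs_nonneg _).trans hz) ht0) (hperp w huw).symm
  set ψ := (i : ℝ) * aperture m with hψ
  set t := Real.tan (aperture m / 2) with ht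
  have hcl : ∀ d d' : Plane, 0 < hgt ψ d → 0 < hgt ψ d' →
      (0 < cr d d' ↔ lat ψ d / hgt ψ d < lat ψ d' / hgt ψ d') := by
    intro d d' h h'
    rw [cr_eq ψ, div_lt_div_iff₀ h h', sub_pos, mul_comm (hgt ψ d)]
  have hdiv : ∀ d, IsDivider m S u i d → InWedge t ψ d ∧ 0 < hgt ψ d :=
    fun d hd => hd.inWedge hm hperp
  have hleft : 0 < cr (leftRay m i) ((w : Plane) - u) := by
    have h1 : cr (leftRay m i) ((w : Plane) - u)
        = Real.cos (aperture m / 2) * lat ψ ((w : Plane) - u)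
          + Real.sin (aperture m / 2) * hgt ψ ((w : Plane) - u) := by
      rw [cr_eq ψ, leftRay_eq, hgt_direction, lat_direction, add_sub_cancel_left, Real.cos_neg,
        Real.sin_neg]
      ring
    refine lt_of_le_of_ne ?_ fun h0 => ?_
    · rw [h1, ← Real.tan_mul_cos hc.ne']
      have := (abs_le.1 hz).1
      nlinarith
    · have hne : leftRay m i ≠ 0 := fun h => by
        have := ((hdiv _ (Or.inl rfl)).2).ne'
        rw [h] at this
        simp [hgt] at this
      obtain ⟨r, hr⟩ := exists_smul_of_cr_eq_zero hne h0.symm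
      -- The left border of cone i is the right border of cone i - 1.
      refine hgp.not_parallel u u.2 w w.2 (fun h => huw (Subtype.ext h)) (i - 1) r ?_
      rw [hr, leftRay_eq, rightRay_eq]
      congr 2
      push_cast
      ring
  -- Dividers are ordered by slope. A divider through w itself, as when uw is a constraint, is put
  -- in `D₂`, so the subcone taken is the one to its left.
  let D₁ : Set Plane := {d | IsDivider m S u i d ∧
    lat ψ d / hgt ψ d < lat ψ ((w : Plane) - u) / hgt ψ ((w : Plane) - u)}
  let D₂ : Set Plane := {d | IsDivider m S u i d ∧
    lat ψ ((w : Plane) - u) / hgt ψ ((w : Plane) - u) ≤ lat ψ d / hgt ψ d}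
  obtain ⟨d₁, ⟨h1, h1'⟩, hmax⟩ := Set.exists_max_image D₁ (fun d => lat ψ d / hgt ψ d)
    ((finite_divider m S u i).subset fun d hd => hd.1)
    ⟨leftRay m i, Or.inl rfl, (hcl _ _ (hdiv _ (Or.inl rfl)).2 hz0).1 hleft⟩
  obtain ⟨d₂, ⟨h2, h2'⟩, hmin⟩ := Set.exists_min_image D₂ (fun d => lat ψ d / hgt ψ d)
    ((finite_divider m S u i).subset fun d hd => hd.1) ⟨rightRay m i, Or.inr (Or.inl rfl), by
      rw [rightRay_eq, hgt_direction, lat_direction, add_sub_cancel_left,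
        ← Real.tan_eq_sin_div_cos, div_le_iff₀ hz0]
      exact (le_abs_self _).trans hz⟩
  have p1 := (hdiv d₁ h1).2
  have p2 := (hdiv d₂ h2).2
  have h12 : 0 < cr d₁ d₂ := (hcl d₁ d₂ p1 p2).2 (h1'.trans_le h2')
  refine ⟨d₁, d₂, h1, h2, h12, ?_, mem_sector_of_cr h12 ((hcl _ _ p1 hz0).2 h1').le ?_⟩
  · rintro d hd ⟨c1, c2⟩
    have p := (hdiv d hd).2
    have c1' := (hcl _ _ p1 p).1 c1
    have c2' := (hcl _ _ p p2).1 c2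
    rcases lt_or_ge (lat ψ d / hgt ψ d) (lat ψ ((w : Plane) - u) / hgt ψ ((w : Plane) - u))
      with h | h
    · exact absurd (hmax d ⟨hd, h⟩) (not_le.2 c1')
    · exact absurd (hmin d ⟨hd, h⟩) (not_le.2 c2')
  · rw [cr_eq ψ, sub_nonneg, mul_comm (hgt ψ _), ← div_le_div_iff₀ hz0 p2]
    exact h2'

end Subcone

/-! ### The induction on the distance. -/

/-- The path bound holds for all pairs of vertices that see each other, in every cone. -/
lemma reach_of_visible {k x : ℕ} (hk : 1 ≤ k) (hx : x = 3 ∨ x = 4 ∨ x = 5) {c : ℝ}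
    (hc : c = ratio x (aperture (4 * k + x))) {P : Finset Plane} {S : SimpleGraph P}
    (hgp : GeneralPosition (4 * k + x) P) (hS : PlanarConstraints S) (u w : P)
    (huw : (visibilityGraph S).Adj u w) (i : ℤ) (hw : (w : Plane) ∈ cone (4 * k + x) u i) :
    Reach (constrainedThetaGraph (4 * k + x) S) u w
      (pathBound (aperture (4 * k + x)) c (i * aperture (4 * k + x)) ((w : Plane) - u)) := by
  have hm : 7 ≤ 4 * k + x := by omega
  have hc1 : 1 ≤ c := hc ▸ one_le_ratio x (aperture_pos hm) (aperture_le hm)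
  have hP := hgp.noThreeCollinear
  have hne : ∀ (i : ℤ) (p q : P), p ≠ q → hgt (i * aperture (4 * k + x)) ((q : Plane) - p) ≠ 0 := by
    intro i p q hpq
    rw [← inner_direction]
    exact hgp.not_perpendicular p p.2 q q.2 (fun h => hpq (Subtype.ext h)) i
  obtain ⟨uw, huw'⟩ : ∃ uw : P × P, uw = (u, w) := ⟨_, rfl⟩
  induction uw using (wellFounded_of_real fun a : P × P => dist (a.1 : Plane) a.2).induction
    generalizing u w i with
  | _ uw ih =>
  subst huw'
  set m := 4 * k + x with hmdef
  set ψ := (i : ℝ) * aperture m with hψ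
  have hedge : ∀ p q : P, (visibilityGraph S).Adj p q →
      dist (p : Plane) q < dist (u : Plane) w → 0 ≤ hgt ψ ((q : Plane) - p) →
      Reach (constrainedThetaGraph m S) p q (pathBound (aperture m) c ψ ((q : Plane) - p)) := by
    intro p q hpq hd h0
    -- The cone may belong to q; the hypothesis then serves the reversed pair, at the same distance.
    rcases exists_cheaper_cone hk hx hc h0 with ⟨j, hj, hle⟩ | ⟨j, hj, hle⟩
    · exact (ih (p, q) hd p q hpq j hj rfl).mono hle
    · exact ((ih (q, p) (by simpa [dist_comm] using hd) q p hpq.symm j hj rfl).symm).mono hle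
  obtain ⟨d₁, d₂, h1, h2, h12, hcons, hwK⟩ := exists_subcone (S := S) hm hgp huw.1 (hne i u) hw
  have hw1 := inWedge_of_mem_cone hm hw
  have hKw : ∀ z ∈ sector (u : Plane) d₁ d₂,
      InWedge (Real.tan (aperture m / 2)) ψ (z - u) := by
    rintro z ⟨s, t, hs, ht, rfl⟩
    rw [add_assoc, add_sub_cancel_left]
    exact ((h1.inWedge hm (hne i u)).1.smul hs).add ((h2.inWedge hm (hne i u)).1.smul ht)
  have hK0 : ∀ z ∈ sector (u : Plane) d₁ d₂, 0 ≤ hgt ψ (z - u) := fun z hz =>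
    nonneg_of_mul_nonneg_right ((abs_nonneg _).trans (hKw z hz)) (tan_half_aperture_pos hm)
  obtain ⟨v, ⟨huv, hvK⟩, hmin⟩ := Set.exists_min_image
    {v : P | (visibilityGraph S).Adj u v ∧ (v : Plane) ∈ sector (u : Plane) d₁ d₂}
    (fun v => hgt ψ ((v : Plane) - u)) (Set.toFinite _) ⟨w, huw, hwK⟩
  have hadj : (constrainedThetaGraph m S).Adj u v := by
    refine Or.inl ⟨huv, i, _, ⟨d₁, d₂, h1, h2, h12, hcons, rfl⟩, hvK, fun z hz hzK => ?_⟩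
    rw [dist_bisectorProj, dist_bisectorProj, abs_of_nonneg (hK0 v hvK), abs_of_nonneg (hK0 z hzK)]
    exact hmin z ⟨hz, hzK⟩
  have hreach : ∀ σ : ℝ, |σ| = 1 → Reach (constrainedThetaGraph m S) u v
      (sideBound (aperture m) c ψ σ ((v : Plane) - u)) := fun σ hσ => by
    refine (reach_of_adj hadj).mono ?_
    rw [dist_comm, dist_eq_norm]
    exact norm_le_sideBound hm hc1 hσ (hKw v hvK)
  by_cases hvw : v = w
  · subst hvw
    exact (hreach 1 (by simp)).mono (sideBound_le_pathBound (by linarith) (by simp) _)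
  have hD := hP u v w huv.1 hvw huw.1
  have chain : ∀ σ : ℝ, |σ| = 1 → 0 < σ * cr ((v : Plane) - u) ((w : Plane) - u) →
      Reach (constrainedThetaGraph m S) u w
        (pathBound (aperture m) c ψ ((w : Plane) - u)) := by
    intro σ hσ hcr
    refine reach_of_chain hm _ hP hS (by linarith) hσ (hne i) hedge huw hw1 v huv hcr
      (hKw v hvK) ?_ ?_ (Or.inl (hreach σ hσ))
    · rintro q hq ⟨hs, ht⟩
      have hqK : (q : Plane) ∈ sector (u : Plane) d₁ d₂ :=
        sector_combo hs.le ht.le hvK hwK (sub_eq_iff_eq_add'.2 (eq_frame hD q))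
      have hqc : (q : Plane) ∈ cone m u i :=
        (mem_cone_iff (sin_half_aperture_pos hm) (cos_half_aperture_pos hm) _ _ _).2 (hKw q hqK)
      refine hcons _ (Or.inr (Or.inr ⟨q, hq, hqc, rfl⟩)) ?_
      change 0 < cr d₁ (q - u) ∧ 0 < cr (q - u) d₂
      obtain ⟨a, b, ha, hb, ea⟩ := hvK
      obtain ⟨a', b', ha', hb', ea'⟩ := hwK
      have eq := sub_eq_iff_eq_add'.2 (eq_frame hD (q : Plane))
      set s := bcl (u : Plane) v w q
      set t := bcr (u : Plane) v w q
      have e1 : (v : Plane) - u = a • d₁ + b • d₂ := by rw [ea]; abel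
      have e2 : (w : Plane) - u = a' • d₁ + b' • d₂ := by rw [ea']; abel
      -- Since v and w are not both on one border of the subcone, a direction strictly between them
      -- is strictly inside it, against the consecutiveness of `d₁` and `d₂`.
      have hD' : (a * b' - b * a') * cr d₁ d₂ ≠ 0 := by
        convert hD using 1
        rw [e1, e2]
        simp [cr]
        ring
      have hab := left_ne_zero_of_mul hD'
      have e3 : cr d₁ (q - u) = (s * b + t * b') * cr d₁ d₂ := by
        rw [eq, e1, e2]; simp [cr]; ring
      have e4 : cr (q - u) d₂ = (s * a + t * a') * cr d₁ d₂ := by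
        rw [eq, e1, e2]; simp [cr]; ring
      have pos_of : ∀ b b' : ℝ, 0 ≤ b → 0 ≤ b' → ¬ (b = 0 ∧ b' = 0) → 0 < s * b + t * b' := by
        intro b b' hb hb' hn
        rcases hb.eq_or_lt with h | h
        · have : 0 < b' := hb'.lt_of_ne fun h' => hn ⟨h.symm, h'.symm⟩
          positivity
        · positivity
      rw [e3, e4]
      refine ⟨mul_pos (pos_of b b' hb hb' ?_) h12, mul_pos (pos_of a a' ha ha' ?_) h12⟩
      · rintro ⟨rfl, rfl⟩
        simp at hab
      · rintro ⟨rfl, rfl⟩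
        simp at hab
    · rintro z hz hs ht -
      have hzK : (z : Plane) ∈ sector (u : Plane) d₁ d₂ :=
        sector_combo hs ht hvK hwK (sub_eq_iff_eq_add'.2 (eq_frame hD z))
      have := hmin z ⟨hz, hzK⟩
      simp only [hgt_sub] at this ⊢
      linarith
  rcases lt_or_gt_of_ne hD with h | h
  · exact chain (-1) (by simp) (by linarith)
  · exact chain 1 (by simp) (by linarith)

/-! ### The bound in terms of the angle α. -/

lemma canonicalMidpoint_sub {m : ℕ} (hm : 7 ≤ m) (u w : Plane) (i : ℤ) :
    canonicalMidpoint m u i w - u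
      = hgt (i * aperture m) (w - u) • direction (i * aperture m) := by
  have hc := cos_half_aperture_pos hm
  unfold canonicalMidpoint leftCorner rightCorner bisector
  rw [inner_direction, midpoint_eq_smul_add, leftRay_eq, rightRay_eq]
  apply plane_ext <;> simp [direction, Real.sin_add, Real.cos_add] <;> field_simp <;> ring

/-- The path bound in terms of the angle to the midpoint of the canonical triangle. -/
lemma pathBound_eq_angle {m : ℕ} (hm : 7 ≤ m) {u w : Plane} {i : ℤ} {c : ℝ}
    (h : 0 < hgt (i * aperture m) (w - u)) :
    pathBound (aperture m) c (i * aperture m) (w - u)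
      = (Real.cos (EuclideanGeometry.angle w u (canonicalMidpoint m u i w))
            / Real.cos (aperture m / 2)
          + (Real.cos (EuclideanGeometry.angle w u (canonicalMidpoint m u i w))
              * Real.tan (aperture m / 2)
            + Real.sin (EuclideanGeometry.angle w u (canonicalMidpoint m u i w))) * c)
        * dist u w := by
  have hang : EuclideanGeometry.angle w u (canonicalMidpoint m u i w)
      = InnerProductGeometry.angle (w - u) (direction (i * aperture m)) := by
    rw [EuclideanGeometry.angle, vsub_eq_sub, vsub_eq_sub, canonicalMidpoint_sub hm,
      InnerProductGeometry.angle_smul_right_of_pos _ _ h]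
  have hn : ‖direction (i * aperture m)‖ = 1 := by
    rw [← sq_eq_sq₀ (norm_nonneg _) zero_le_one, norm_sq_eq (i * aperture m), hgt_direction,
      lat_direction]
    simp
  rw [hang]
  set α := InnerProductGeometry.angle (w - u) (direction (i * aperture m)) with hα
  have hcos : Real.cos α * ‖w - u‖ = hgt (i * aperture m) (w - u) := by
    have := InnerProductGeometry.cos_angle_mul_norm_mul_norm (w - u) (direction (i * aperture m))
    rwa [hn, mul_one, inner_direction] at this
  have hsin : Real.sin α * ‖w - u‖ = |lat (i * aperture m) (w - u)| := by
    rw [← abs_of_nonneg (mul_nonneg (InnerProductGeometry.sin_angle_nonneg _ _) (norm_nonneg _)),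
      ← sq_eq_sq_iff_abs_eq_abs]
    have h1 := norm_sq_eq (i * aperture m) (w - u)
    rw [← hcos] at h1
    nlinarith [Real.sin_sq_add_cos_sq α]
  rw [pathBound, ← hcos, ← hsin, dist_comm, dist_eq_norm]
  ring

end ConstrainedTheta

theorem mainTheorem3 (k x : ℕ) (hk : 1 ≤ k) (hx : x = 3 ∨ x = 4 ∨ x = 5)
    (θ c : ℝ) (hθ : θ = 2 * Real.pi / (4 * k + x))
    (hc : c = if x = 4 then 1 / (Real.cos (θ / 2) - Real.sin (θ / 2))
      else Real.cos (θ / 4) / (Real.cos (θ / 2) - Real.sin (3 * θ / 4))) :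
    1 ≤ c ∧
    ∀ (P : Finset Plane) (S : SimpleGraph P),
      GeneralPosition (4 * k + x) P → PlanarConstraints S →
      ∀ u w : P, (visibilityGraph S).Adj u w →
      ∀ i : ℤ, (w : Plane) ∈ cone (4 * k + x) u i →
      ∀ α : ℝ, α = EuclideanGeometry.angle (w : Plane) u (canonicalMidpoint (4 * k + x) u i w) →
      ∃ p : (constrainedThetaGraph (4 * k + x) S).Walk u w, p.IsPath ∧
        walkLength p ≤
          (Real.cos α / Real.cos (θ / 2)
              + (Real.cos α * Real.tan (θ / 2) + Real.sin α) * c) * dist (u : Plane) w := by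
  have hm : 7 ≤ 4 * k + x := by omega
  have hθ' : θ = aperture (4 * k + x) := by
    rw [hθ, aperture]
    push_cast
    rfl
  have hc' : c = ratio x θ := hc
  rw [hθ'] at hc'
  refine ⟨hc' ▸ one_le_ratio x (aperture_pos hm) (aperture_le hm), ?_⟩
  rintro P S hgp hS u w huw i hw α rfl
  have h0 : 0 < hgt (i * aperture (4 * k + x)) ((w : Plane) - u) := by
    refine lt_of_le_of_ne (nonneg_of_mul_nonneg_right
      ((abs_nonneg _).trans (inWedge_of_mem_cone hm hw)) (tan_half_aperture_pos hm)) ?_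
    rw [← inner_direction]
    exact (hgp.not_perpendicular u u.2 w w.2 (fun h => huw.1 (Subtype.ext h)) i).symm
  rw [hθ', ← pathBound_eq_angle hm h0]
  exact reach_of_visible hk hx hc' hgp hS u w huw i hw
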